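/- Let $B=(f_1,f_2,f_3)$ be the Borromean rings in $\mathbb R^3$, where $$f_1(x)=(0,2\cos x,\sin x),\qquad f_2(y)=(\cos y,0,2\sin y),\qquad f_3(z)=(2\cos z,\sin z,0)$$ for $x,y,z\in S^1$, and let $U=(f_1,e_2,f_3)$ with $e_2(y)=(\cos y,4,2\sin y)$. For $y\in S^1$ and $t\in[0,4]$ put $$H_1(y,t)=(\cos y,t,2\sin y),\qquad H_3(y,t)=(\cos y,t,2\sin y-(t-2)^2+4),$$ and let $G:S^1\times S^1\times[0,4]\times[0,1]\to\mathbb R^3\times\mathbb R^3$, $$G(y,z,t,s)=\bigl(f_3(z),\ sH_3(y,t)+(1-s)H_1(y,t)\bigr).$$ Let $\Delta\subset\mathbb R^3\times\mathbb R^3$ be the diagonal. (1) $G$, together with its restrictions to all boundary strata, is transverse to $\Delta$. The preimage $G^{-1}(\Delta)$ is a smoothly embedded arc, and each of the two projections to the $S^1$ factors restricts to a topological embedding of it. (2) A point of the second Taylor stage $\mathcal T_2\mathrm{Link}(S^1,S^1,S^1;\mathbb R^3)$ is modelled by three smooth maps $g_1,g_2,g_3:S^1\to\mathbb R^3$ together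 with, for each of the ordered pairs $(h,i)=(1,3),(3,2),(2,1)$, a homotopy $H_{hi}:S^1\times S^1\times[0,1]\to\mathbb R^3\times\mathbb R^3$ from $g_h\times g_i$ to a map that misses $\Delta$; a link map (that is, a triple of smooth maps with pairwise disjoint images) gives the point with constant homotopies. A path in this space, with time $u\in[0,a]$, has an obstruction manifold $Z$, which is glued from nine pieces. Let $(h,i,j)$ run through $(1,3,2),(3,2,1),(2,1,3)$ and let $x_1,x_2,x_3\in S^1$, $u\in[0,a]$. Suppress $u$ and write $p_1,p_2$ for the two projections of $\mathbb R^3\times\mathbb R^3$. The pieces are the preimages of $\Delta\times\Delta$ under $$\begin{aligned} \Phi_{hij}&=(H_{hi}(x_h,x_i,s),\,H_{ij}(x_i,x_j,t)), && 0\le s,t\le1,\\ \Phi_{1,(hi)j}&=(g_j(x_j),\,p_1H_{hi}(x_h,x_i,s),\,H_{hi}(x_h,x_i,t)), && 0\le s\le t\le 1,\\ \Phi_{2,(hi)j}&=(H_{hi}(x_h,x_i,s),\,p_2H_{hi}(x_h,x_i,t),\,g_j(x_j)), && 0\le t\le s\le1. \end{aligned}$$ Points with the same coordinates $(x_1,x_2,x_3,s,t,u)$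 are identified as follows: $\Phi_{hij}^{-1}$ with $\Phi_{2,(hi)j}^{-1}$ where $t=0$, $\Phi_{hij}^{-1}$ with $\Phi_{1,(ij)h}^{-1}$ where $s=0$, and $\Phi_{1,(hi)j}^{-1}$ with $\Phi_{2,(hi)j}^{-1}$ where $s=t$. The triples $B$ and $U$ are link maps, and $U$ is an unlink, that is, its components bound pairwise disjoint smoothly embedded disks. The components $(f_1,H_1(\cdot,u),f_3)$, $u\in[0,4]$, with the constant homotopies of $f_1\times f_3$ and of $H_1(\cdot,u)\times f_1$ for the pairs $(1,3)$ and $(2,1)$, and with the homotopy $(z,y,s)\mapsto G(y,z,u,s)$ for the pair $(3,2)$, form a smooth path in the second stage from the image of $B$ to the image of $U$. For this path all nine maps $\Phi$ and their restrictions to all boundary strata are transverse to $\Delta\times\Delta$, and the obstruction manifold $Z$ is a single point. (3) $B$ is not link homotopic to $U$, nor to any other unlink of three components: no continuous homotopy of the three components from $B$ to an unlink keeps the images of different components disjoint at all times. -/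

import Mathlib

open Set
open scoped ContDiff

namespace BorromeanRings

/-- Euclidean three-space. -/
abbrev E3 : Type := EuclideanSpace ℝ (Fin 3)

/-! ### Link maps of three circles in three-space

The circle is the unit circle `Circle` in `ℂ`; the point with angle `θ` is `Circle.exp θ`, and
its cosine and sine are its real and imaginary parts.  Smoothness of, and derivatives along, maps
out of circles are taken in the angle coordinates given by the local diffeomorphism
`Circle.exp : ℝ → Circle`. -/

/-- Three maps of a circle have pairwise disjoint images. -/
def DisjointImages (f : Fin 3 → Circle → E3) : Prop :=
  Pairwise fun i j => Disjoint (range (f i)) (range (f j))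

/-- A link map: three smooth maps of a circle with pairwise disjoint images. -/
def IsLinkMap (f : Fin 3 → Circle → E3) : Prop :=
  (∀ i, ContDiff ℝ ∞ fun θ : ℝ => f i (Circle.exp θ)) ∧ DisjointImages f

/-- `f` and `g` are link homotopic: they are joined by a homotopy of the three components during
which the images of different components stay disjoint at all times.  (The homotopy is only asked
to be continuous, so the negation also excludes smooth link homotopies.) -/
def LinkHomotopic (f g : Fin 3 → Circle → E3) : Prop :=
  ∃ h : Fin 3 → unitInterval → Circle → E3,
    (∀ i, Continuous fun p : unitInterval × Circle => h i p.1 p.2) ∧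
    (∀ τ, DisjointImages fun i => h i τ) ∧
    (∀ i, h i 0 = f i) ∧ (∀ i, h i 1 = g i)

/-- An unlink of three components: the components bound pairwise disjoint smoothly embedded
closed disks. -/
def IsUnlink (f : Fin 3 → Circle → E3) : Prop :=
  ∃ D : Fin 3 → ℂ → E3,
    (∀ i, ContDiff ℝ ∞ (D i)) ∧
    (∀ i, InjOn (D i) (Metric.closedBall 0 1)) ∧
    (∀ i, ∀ w ∈ Metric.closedBall (0 : ℂ) 1, Function.Injective (fderiv ℝ (D i) w)) ∧
    (∀ i (z : Circle), D i (z : ℂ) = f i z) ∧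
    Pairwise fun i j =>
      Disjoint (D i '' Metric.closedBall 0 1) (D j '' Metric.closedBall 0 1)

/-! ### Transversality on domains with corners -/

/-- The diagonal of `ℝ³ × ℝ³`. -/
def diag : Submodule ℝ (E3 × E3) :=
  LinearMap.eqLocus (LinearMap.fst ℝ E3 E3) (LinearMap.snd ℝ E3 E3)

/-- The directions tangent at `p` to the smallest stratum (open face) of the convex polyhedron `K`
through `p`: those in which one can move a little both ways inside `K`. -/
def stratumDirections {V : Type*} [NormedAddCommGroup V] [NormedSpace ℝ V]
    (K : Set V) (p : V) : Submodule ℝ V :=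
  Submodule.span ℝ {v | ∃ ε > 0, ∀ r : ℝ, |r| < ε → p + r • v ∈ K}

/-- The map `Φ`, on the convex polyhedron `K`, is transverse to the linear subspace `S`, and so are
its restrictions to all strata of `K`.  (Transversality on the smallest stratum through a point is
the strongest of these conditions at that point.) -/
def TransverseOn {V W : Type*} [NormedAddCommGroup V] [NormedSpace ℝ V]
    [NormedAddCommGroup W] [NormedSpace ℝ W]
    (K : Set V) (Φ : V → W) (S : Submodule ℝ W) : Prop :=
  ∀ p ∈ K, Φ p ∈ S →
    Submodule.map (fderiv ℝ Φ p : V →ₗ[ℝ] W) (stratumDirections K p) ⊔ S = ⊤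

/-! ### Paths in the second Taylor stage of the space of link maps

A point of the second stage is a triple of maps `f i : S¹ → ℝ³` together with, for each pair of
components, a homotopy `H` of maps `S¹ × S¹ → ℝ³ × ℝ³` from the product of the two components to a
map that misses the diagonal.  The components are indexed by `Fin 3`, and the three pairs are taken
in the cyclic order `(h, h + 2)`, that is `(0, 2), (2, 1), (1, 0)`. -/

/-- The data of a path in the second stage: `f i x u` is the `i`-th component at path time `u`, and
`H h x y s u` is the homotopy (with parameter `s`) for the pair `(h, h + 2)` at path time `u`. -/
structure PathData where
  f : Fin 3 → Circle → ℝ → E3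
  H : Fin 3 → Circle → Circle → ℝ → ℝ → E3 × E3

/-- `L` is a smooth path, parametrized by `[0, a]`, in the second stage. -/
def IsStagePath (a : ℝ) (L : PathData) : Prop :=
  (∀ i, ContDiff ℝ ∞ fun p : ℝ × ℝ => L.f i (Circle.exp p.1) p.2) ∧
  (∀ h, ContDiff ℝ ∞ fun p : ℝ × ℝ × ℝ × ℝ =>
    L.H h (Circle.exp p.1) (Circle.exp p.2.1) p.2.2.1 p.2.2.2) ∧
  (∀ h x y, ∀ u ∈ Icc 0 a, L.H h x y 0 u = (L.f h x u, L.f (h + 2) y u)) ∧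
  (∀ h x y, ∀ u ∈ Icc 0 a, L.H h x y 1 u ∉ diag)

/-- At time `u` the path `L` is at the image of the link map `f` in the second stage: the components
are those of `f` and the homotopies are constant. -/
def AtLinkMap (L : PathData) (u : ℝ) (f : Fin 3 → Circle → E3) : Prop :=
  (∀ i x, L.f i x u = f i x) ∧
  (∀ h x y, ∀ s ∈ Icc (0 : ℝ) 1, L.H h x y s u = (f h x, f (h + 2) y))

/-! ### The obstruction manifold of a path

Write `i = h + 2` and `j = h + 1`, so that `(h, i, j)` runs through the cyclic orderings and the
pairs `(h, i)` and `(i, j)` are among the three chosen ones. -/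

/-- Labels of the nine pieces of the obstruction manifold: the intersections `circles h` of the
Whitney circles of the pairs `(h, i)` and `(i, j)`, and the intersections `disk₁ h`, `disk₂ h` of
the `j`-th component with the two halves of the Whitney disk of the pair `(h, i)`. -/
inductive Piece : Type
  | circles (h : Fin 3)
  | disk₁ (h : Fin 3)
  | disk₂ (h : Fin 3)

/-- The points `(x, s, t, u)`: one point on each circle, two homotopy parameters, a path time. -/
abbrev Param : Type := (Fin 3 → Circle) × ℝ × ℝ × ℝ

/-- The domain of the parameters `(s, t, u)` for each piece. -/
def paramDomain (a : ℝ) : Piece → Set (ℝ × ℝ × ℝ)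
  | .circles _ => {q | q.1 ∈ Icc 0 1 ∧ q.2.1 ∈ Icc 0 1 ∧ q.2.2 ∈ Icc 0 a}
  | .disk₁ _ => {q | (0 ≤ q.1 ∧ q.1 ≤ q.2.1 ∧ q.2.1 ≤ 1) ∧ q.2.2 ∈ Icc 0 a}
  | .disk₂ _ => {q | (0 ≤ q.2.1 ∧ q.2.1 ≤ q.1 ∧ q.1 ≤ 1) ∧ q.2.2 ∈ Icc 0 a}

/-- The maps to `(ℝ³)⁴` that define the pieces. -/
def pieceMap (L : PathData) : Piece → Param → (E3 × E3) × (E3 × E3)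
  | .circles h, (x, s, t, u) =>
      (L.H h (x h) (x (h + 2)) s u, L.H (h + 2) (x (h + 2)) (x (h + 1)) t u)
  | .disk₁ h, (x, s, t, u) =>
      ((L.f (h + 1) (x (h + 1)) u, (L.H h (x h) (x (h + 2)) s u).1),
        L.H h (x h) (x (h + 2)) t u)
  | .disk₂ h, (x, s, t, u) =>
      (L.H h (x h) (x (h + 2)) s u,
        ((L.H h (x h) (x (h + 2)) t u).2, L.f (h + 1) (x (h + 1)) u))

/-- A piece is the preimage of the product of two diagonals. -/
def pieceSet (a : ℝ) (L : PathData) (k : Piece) : Set Param :=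
  {p | p.2 ∈ paramDomain a k ∧ pieceMap L k p ∈ diag.prod diag}

/-- All maps defining pieces, and their restrictions to all strata, are transverse. -/
def IsTransversePath (a : ℝ) (L : PathData) : Prop :=
  ∀ k, TransverseOn {p : (Fin 3 → ℝ) × ℝ × ℝ × ℝ | p.2 ∈ paramDomain a k}
    (fun p => pieceMap L k (fun i => Circle.exp (p.1 i), p.2)) (diag.prod diag)

/-- The identifications of boundary parts of the pieces. -/
inductive Glue (a : ℝ) (L : PathData) :
    (Σ k, pieceSet a L k) → (Σ k, pieceSet a L k) → Prop
  | t_zero (h : Fin 3) (p : Param) (h₁ : p ∈ pieceSet a L (.circles h))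
      (h₂ : p ∈ pieceSet a L (.disk₂ h)) (ht : p.2.2.1 = 0) :
      Glue a L ⟨.circles h, p, h₁⟩ ⟨.disk₂ h, p, h₂⟩
  | s_zero (h : Fin 3) (p : Param) (h₁ : p ∈ pieceSet a L (.circles h))
      (h₂ : p ∈ pieceSet a L (.disk₁ (h + 2))) (hs : p.2.1 = 0) :
      Glue a L ⟨.circles h, p, h₁⟩ ⟨.disk₁ (h + 2), p, h₂⟩
  | s_eq_t (h : Fin 3) (p : Param) (h₁ : p ∈ pieceSet a L (.disk₁ h))
      (h₂ : p ∈ pieceSet a L (.disk₂ h)) (hst : p.2.1 = p.2.2.1) :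
      Glue a L ⟨.disk₁ h, p, h₁⟩ ⟨.disk₂ h, p, h₂⟩

/-- The obstruction manifold of a path: the nine pieces glued along their boundaries. -/
def ObstructionManifold (a : ℝ) (L : PathData) : Type :=
  Quot (Glue a L)

/-! ### The example -/

/-- `f₁(x) = (0, 2 cos x, sin x)`. -/
noncomputable def f₁ (x : Circle) : E3 := !₂[0, 2 * (x : ℂ).re, (x : ℂ).im]

/-- `f₂(y) = (cos y, 0, 2 sin y)`. -/
noncomputable def f₂ (y : Circle) : E3 := !₂[(y : ℂ).re, 0, 2 * (y : ℂ).im]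

/-- `f₃(z) = (2 cos z, sin z, 0)`. -/
noncomputable def f₃ (z : Circle) : E3 := !₂[2 * (z : ℂ).re, (z : ℂ).im, 0]

/-- `e₂(y) = (cos y, 4, 2 sin y)`. -/
noncomputable def e₂ (y : Circle) : E3 := !₂[(y : ℂ).re, 4, 2 * (y : ℂ).im]

/-- The Borromean rings. -/
noncomputable def borromean : Fin 3 → Circle → E3 := ![f₁, f₂, f₃]

/-- The unlink. -/
noncomputable def unlink : Fin 3 → Circle → E3 := ![f₁, e₂, f₃]

/-- `H₁(y, t) = (cos y, t, 2 sin y)`. -/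
noncomputable def H₁ (y : Circle) (t : ℝ) : E3 := !₂[(y : ℂ).re, t, 2 * (y : ℂ).im]

/-- `H₃(y, t) = (cos y, t, 2 sin y - (t - 2)² + 4)`. -/
noncomputable def H₃ (y : Circle) (t : ℝ) : E3 :=
  !₂[(y : ℂ).re, t, 2 * (y : ℂ).im - (t - 2) ^ 2 + 4]

/-- `G(y, z, t, s) = (f₃(z), s H₃(y, t) + (1 - s) H₁(y, t))`. -/
noncomputable def G (y z : Circle) (t s : ℝ) : E3 × E3 :=
  (f₃ z, s • H₃ y t + (1 - s) • H₁ y t)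

/-- The preimage of the diagonal under `G` in `S¹ × S¹ × [0, 4] × [0, 1]`. -/
def preimageG : Set (Circle × Circle × ℝ × ℝ) :=
  {q | q.2.2.1 ∈ Icc 0 4 ∧ q.2.2.2 ∈ Icc 0 1 ∧ G q.1 q.2.1 q.2.2.1 q.2.2.2 ∈ diag}

/-- A smoothly embedded arc in `S¹ × S¹ × ℝ × ℝ`. -/
def IsSmoothArc (A : Set (Circle × Circle × ℝ × ℝ)) : Prop :=
  ∃ γ : ℝ → ℝ × ℝ × ℝ × ℝ, ContDiff ℝ ∞ γ ∧ (∀ r ∈ Icc (0 : ℝ) 1, deriv γ r ≠ 0) ∧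
    InjOn (fun r => (Circle.exp (γ r).1, Circle.exp (γ r).2.1, (γ r).2.2)) (Icc 0 1) ∧
    (fun r => (Circle.exp (γ r).1, Circle.exp (γ r).2.1, (γ r).2.2)) '' Icc 0 1 = A

/-- The path in the second stage: the components are `(f₁, H₁(·, u), f₃)`, the homotopies for the
pairs (first, third) and (second, first) are constant, the one for (third, second) is `G`. -/
noncomputable def liftedPath : PathData where
  f := ![fun x _ => f₁ x, fun y u => H₁ y u, fun z _ => f₃ z]
  H := ![fun x z _ _ => (f₁ x, f₃ z), fun y x _ u => (H₁ y u, f₁ x), fun z y s u => G y z u s]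

end BorromeanRings

open BorromeanRings

/-! Part (3) is homotopy theory. If the components are disjoint, the differences `a - b`, `b - c`,
`c - a` of points on them are nonzero with sum zero, so they do not all have the same direction
(`admissible_linkVec`). A spinor in the direction of `v` is an eigenvector in ℂ² of the Pauli matrix
of `v` for the eigenvalue `‖v‖`. Two spinors are proportional only if their directions agree. So a
continuous choice of spinors for the three differences gives a map (ψ₀ ∧ ψ₁, ψ₁ ∧ ψ₂) from the
three-torus to ℂ² ∖ 0. Spinors can be carried along a homotopy of admissible triples, and the map
then changes by a homotopy (`IsSpinorMap.exists_homotopic`).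

For an unlink, the disks are shrunk to their centres. The differences become constant, one of the
two wedges never vanishes, and the map is null-homotopic (`IsSpinorMap.exists_homotopic_const`). For
the Borromean rings, the differences deform to three great circles in the coordinate planes, where
spinors can be written down. They give the explicit map `stdMap`.

That `stdMap` is essential is shown by an integral in place of a degree. The three-form q₀ dq₁ ∧ dq₂
∧ dq₃ on ℂ² is supported near a half-axis and closed outside a small cube at the origin. By the
divergence theorem its integral over the torus does not change under homotopies that avoid the cube
(`flux_eq`). It is zero for a constant map and negative for `stdMap` (`flux_std_neg`), where the
integrand has one sign.

Part (1) is a computation: G meets the diagonal where 2 cos z = cos y, sin z = t and 2 sin y + s(4t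
- t²) = 0, which is solved by letting y run through the lower half circle. In part (2) the first
component meets neither the third nor the moving second one, so only one of the nine pieces can be
nonempty (`eq_disk₂_of_mem`). Its equations have a single solution, in the interior of the domain,
where transversality is an invertible 6 × 6 linear system. -/

namespace BorromeanRings

open MeasureTheory

/-! ### Invariance of the flux of a closed form on the three-torus -/

/-- The partial derivative in the direction of the `j`-th coordinate. -/
noncomputable def pderiv (j : Fin 4) (p : (Fin 4 → ℝ) → ℝ) (x : Fin 4 → ℝ) : ℝ :=
  fderiv ℝ p x (Pi.single j 1)

/-- The Jacobian determinant of three functions with respect to three of the coordinates. -/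
noncomputable def jac (a b c : Fin 4) (p q r : (Fin 4 → ℝ) → ℝ) (x : Fin 4 → ℝ) : ℝ :=
  pderiv a p x * (pderiv b q x * pderiv c r x - pderiv c q x * pderiv b r x)
    - pderiv b p x * (pderiv a q x * pderiv c r x - pderiv c q x * pderiv a r x)
    + pderiv c p x * (pderiv a q x * pderiv b r x - pderiv b q x * pderiv a r x)

theorem contDiff_pderiv {p : (Fin 4 → ℝ) → ℝ} (hp : ContDiff ℝ ∞ p) (j : Fin 4) :
    ContDiff ℝ ∞ (pderiv j p) :=
  (hp.fderiv_right (m := ∞) (by simp)).clm_apply contDiff_const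

theorem contDiff_jac {p q r : (Fin 4 → ℝ) → ℝ} (hp : ContDiff ℝ ∞ p) (hq : ContDiff ℝ ∞ q)
    (hr : ContDiff ℝ ∞ r) (a b c : Fin 4) : ContDiff ℝ ∞ (jac a b c p q r) := by
  have := contDiff_pderiv hp
  have := contDiff_pderiv hq
  have := contDiff_pderiv hr
  unfold jac
  fun_prop

theorem pderiv_comm {p : (Fin 4 → ℝ) → ℝ} (hp : ContDiff ℝ ∞ p) (i j : Fin 4) (x : Fin 4 → ℝ) :
    pderiv i (pderiv j p) x = pderiv j (pderiv i p) x := by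
  have hsymm : IsSymmSndFDerivAt ℝ p x :=
    hp.contDiffAt.isSymmSndFDerivAt (by simp; exact WithTop.coe_le_coe.2 le_top)
  have hd : DifferentiableAt ℝ (fderiv ℝ p) x :=
    ((hp.fderiv_right (m := ∞) (by simp)).differentiable (by simp)) x
  have key : ∀ i j : Fin 4, pderiv i (pderiv j p) x
      = fderiv ℝ (fderiv ℝ p) x (Pi.single i 1) (Pi.single j 1) := by
    intro i j
    unfold pderiv
    rw [fderiv_clm_apply hd (differentiableAt_const _)]
    simp
  rw [key, key]
  exact hsymm _ _

theorem pderiv_mul {p q : (Fin 4 → ℝ) → ℝ} (hp : ContDiff ℝ ∞ p) (hq : ContDiff ℝ ∞ q)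
    (j : Fin 4) (x : Fin 4 → ℝ) :
    pderiv j (fun x => p x * q x) x = p x * pderiv j q x + q x * pderiv j p x := by
  unfold pderiv
  rw [fderiv_fun_mul (hp.differentiable (by simp) x) (hq.differentiable (by simp) x)]
  simp

theorem pderiv_sub {p q : (Fin 4 → ℝ) → ℝ} (hp : ContDiff ℝ ∞ p) (hq : ContDiff ℝ ∞ q)
    (j : Fin 4) (x : Fin 4 → ℝ) :
    pderiv j (fun x => p x - q x) x = pderiv j p x - pderiv j q x := by
  unfold pderiv
  rw [fderiv_fun_sub (hp.differentiable (by simp) x) (hq.differentiable (by simp) x)]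
  simp

theorem pderiv_add {p q : (Fin 4 → ℝ) → ℝ} (hp : ContDiff ℝ ∞ p) (hq : ContDiff ℝ ∞ q)
    (j : Fin 4) (x : Fin 4 → ℝ) :
    pderiv j (fun x => p x + q x) x = pderiv j p x + pderiv j q x := by
  unfold pderiv
  rw [fderiv_fun_add (hp.differentiable (by simp) x) (hq.differentiable (by simp) x)]
  simp

theorem pderiv_jac {p q r : (Fin 4 → ℝ) → ℝ} (hp : ContDiff ℝ ∞ p) (hq : ContDiff ℝ ∞ q)
    (hr : ContDiff ℝ ∞ r) (a b c j : Fin 4) (x : Fin 4 → ℝ) :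
    pderiv j (jac a b c p q r) x =
      pderiv j (pderiv a p) x * (pderiv b q x * pderiv c r x - pderiv c q x * pderiv b r x)
      + pderiv a p x * (pderiv j (pderiv b q) x * pderiv c r x
          + pderiv b q x * pderiv j (pderiv c r) x
          - pderiv j (pderiv c q) x * pderiv b r x - pderiv c q x * pderiv j (pderiv b r) x)
      - pderiv j (pderiv b p) x * (pderiv a q x * pderiv c r x - pderiv c q x * pderiv a r x)
      - pderiv b p x * (pderiv j (pderiv a q) x * pderiv c r x
          + pderiv a q x * pderiv j (pderiv c r) x
          - pderiv j (pderiv c q) x * pderiv a r x - pderiv c q x * pderiv j (pderiv a r) x)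
      + pderiv j (pderiv c p) x * (pderiv a q x * pderiv b r x - pderiv b q x * pderiv a r x)
      + pderiv c p x * (pderiv j (pderiv a q) x * pderiv b r x
          + pderiv a q x * pderiv j (pderiv b r) x
          - pderiv j (pderiv b q) x * pderiv a r x - pderiv b q x * pderiv j (pderiv a r) x) := by
  have h1 := contDiff_pderiv hp
  have h2 := contDiff_pderiv hq
  have h3 := contDiff_pderiv hr
  have m : ∀ k l, ContDiff ℝ ∞ fun x => pderiv k q x * pderiv l r x := fun k l => (h2 k).mul (h3 l)
  have s : ∀ k l, ContDiff ℝ ∞ fun x =>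
      pderiv k q x * pderiv l r x - pderiv l q x * pderiv k r x := fun k l => (m k l).sub (m l k)
  have t : ∀ i k l, ContDiff ℝ ∞ fun x =>
      pderiv i p x * (pderiv k q x * pderiv l r x - pderiv l q x * pderiv k r x) :=
    fun i k l => (h1 i).mul (s k l)
  unfold jac
  rw [pderiv_add ((t a b c).sub (t b a c)) (t c a b), pderiv_sub (t a b c) (t b a c),
    pderiv_mul (h1 a) (s b c), pderiv_mul (h1 b) (s a c), pderiv_mul (h1 c) (s a b),
    pderiv_sub (m b c) (m c b), pderiv_sub (m a c) (m c a), pderiv_sub (m a b) (m b a),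
    pderiv_mul (h2 b) (h3 c), pderiv_mul (h2 c) (h3 b), pderiv_mul (h2 a) (h3 c),
    pderiv_mul (h2 c) (h3 a), pderiv_mul (h2 a) (h3 b), pderiv_mul (h2 b) (h3 a)]
  ring

/-- The pullback of the form `p₀ dp₁ ∧ dp₂ ∧ dp₃`, as a vector field. -/
noncomputable def fluxField (p : Fin 4 → (Fin 4 → ℝ) → ℝ) : Fin 4 → (Fin 4 → ℝ) → ℝ :=
  ![fun x => p 0 x * jac 1 2 3 (p 1) (p 2) (p 3) x,
    fun x => - p 0 x * jac 0 2 3 (p 1) (p 2) (p 3) x,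
    fun x => p 0 x * jac 0 1 3 (p 1) (p 2) (p 3) x,
    fun x => - p 0 x * jac 0 1 2 (p 1) (p 2) (p 3) x]

theorem contDiff_fluxField {p : Fin 4 → (Fin 4 → ℝ) → ℝ} (hp : ∀ i, ContDiff ℝ ∞ (p i))
    (i : Fin 4) : ContDiff ℝ ∞ (fluxField p i) := by
  have h := contDiff_jac (hp 1) (hp 2) (hp 3)
  have h0 := hp 0
  fin_cases i
  · exact h0.mul (h _ _ _)
  · exact h0.neg.mul (h _ _ _)
  · exact h0.mul (h _ _ _)
  · exact h0.neg.mul (h _ _ _)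

theorem pderiv_neg (p : (Fin 4 → ℝ) → ℝ) (j : Fin 4) (x : Fin 4 → ℝ) :
    pderiv j (fun x => - p x) x = - pderiv j p x := by
  unfold pderiv
  rw [fderiv_fun_neg]
  simp

/-- The divergence is the 4 × 4 Jacobian determinant plus `p 0` times an alternating sum of
derivatives of 3 × 3 minors. The sum vanishes by symmetry of second derivatives, the determinant
because it has a zero row. -/
theorem divergence_fluxField {p : Fin 4 → (Fin 4 → ℝ) → ℝ} (hp : ∀ i, ContDiff ℝ ∞ (p i))
    (x : Fin 4 → ℝ) (hx : ∃ i, fderiv ℝ (p i) x = 0) :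
    ∑ i, pderiv i (fluxField p i) x = 0 := by
  have hJ := contDiff_jac (hp 1) (hp 2) (hp 3)
  have e : ∀ i : Fin 4, fderiv ℝ (p i) x = 0 → ∀ j, pderiv j (p i) x = 0 := by
    intro i h j
    simp [pderiv, h]
  rw [Fin.sum_univ_four]
  simp only [fluxField, Matrix.cons_val_zero, Matrix.cons_val_one, Matrix.cons_val]
  rw [pderiv_mul (hp 0) (hJ 1 2 3), pderiv_mul (hp 0).neg (hJ 0 2 3),
    pderiv_mul (hp 0) (hJ 0 1 3), pderiv_mul (hp 0).neg (hJ 0 1 2)]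
  simp only [pderiv_neg]
  have hdiv : pderiv 0 (jac 1 2 3 (p 1) (p 2) (p 3)) x - pderiv 1 (jac 0 2 3 (p 1) (p 2) (p 3)) x
      + pderiv 2 (jac 0 1 3 (p 1) (p 2) (p 3)) x
      - pderiv 3 (jac 0 1 2 (p 1) (p 2) (p 3)) x = 0 := by
    rw [pderiv_jac (hp 1) (hp 2) (hp 3), pderiv_jac (hp 1) (hp 2) (hp 3),
      pderiv_jac (hp 1) (hp 2) (hp 3), pderiv_jac (hp 1) (hp 2) (hp 3)]
    have c (i : Fin 4) := pderiv_comm (hp i)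
    rw [c 1 1 0, c 1 2 0, c 1 3 0, c 1 2 1, c 1 3 1, c 1 3 2,
      c 2 1 0, c 2 2 0, c 2 3 0, c 2 2 1, c 2 3 1, c 2 3 2,
      c 3 1 0, c 3 2 0, c 3 3 0, c 3 2 1, c 3 3 1, c 3 3 2]
    ring
  have hdet : pderiv 0 (p 0) x * jac 1 2 3 (p 1) (p 2) (p 3) x
      - pderiv 1 (p 0) x * jac 0 2 3 (p 1) (p 2) (p 3) x
      + pderiv 2 (p 0) x * jac 0 1 3 (p 1) (p 2) (p 3) x
      - pderiv 3 (p 0) x * jac 0 1 2 (p 1) (p 2) (p 3) x = 0 := by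
    obtain ⟨i, hi⟩ := hx
    unfold jac
    have h := e _ hi
    fin_cases i <;> simp only [Fin.zero_eta, Fin.mk_one, Fin.reduceFinMk] at h <;>
      simp only [h] <;> ring
  linear_combination (p 0 x) * hdiv + hdet

/-- The flux through the torus of side `2π` at time `τ`. -/
noncomputable def flux (p : Fin 4 → (Fin 4 → ℝ) → ℝ) (τ : ℝ) : ℝ :=
  ∫ x in Icc (0 : Fin 3 → ℝ) (fun _ => 2 * Real.pi), fluxField p 0 (Fin.cons τ x)

theorem pderiv_periodic {p : (Fin 4 → ℝ) → ℝ} {v : Fin 4 → ℝ} (hp : ∀ x, p (x + v) = p x)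
    (j : Fin 4) (x : Fin 4 → ℝ) : pderiv j p (x + v) = pderiv j p x := by
  unfold pderiv
  rw [← fderiv_comp_add_right]
  simp only [hp]

theorem fluxField_periodic {p : Fin 4 → (Fin 4 → ℝ) → ℝ} {v : Fin 4 → ℝ}
    (hp : ∀ i x, p i (x + v) = p i x) (j : Fin 4) (x : Fin 4 → ℝ) :
    fluxField p j (x + v) = fluxField p j x := by
  have h (i : Fin 4) := pderiv_periodic (hp i)
  fin_cases j <;> simp [fluxField, jac, h, hp]

/-- The divergence theorem on [0, 1] × [0, 2π]³, where coordinate 0 is the time of the homotopy: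
opposite lateral faces cancel by periodicity, and only the faces at times 0 and 1 remain. -/
theorem flux_eq {p : Fin 4 → (Fin 4 → ℝ) → ℝ} (hp : ∀ i, ContDiff ℝ ∞ (p i))
    (hper : ∀ i (k : Fin 3) x, p i (x + Pi.single k.succ (2 * Real.pi)) = p i x)
    (hx : ∀ x, x 0 ∈ Icc (0 : ℝ) 1 → ∃ i, fderiv ℝ (p i) x = 0) :
    flux p 1 = flux p 0 := by
  have hpi := Real.pi_pos
  set a : Fin 4 → ℝ := 0
  set b : Fin 4 → ℝ := Fin.cons 1 (fun _ => 2 * Real.pi) with hb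
  have hle : a ≤ b := by
    intro i
    refine Fin.cases ?_ (fun j => ?_) i
    · simp [a, b]
    · simp [a, b, hpi.le]
  have hdiv := integral_divergence_of_hasFDerivAt_off_countable' a b hle (fluxField p)
    (fun i x => fderiv ℝ (fluxField p i) x) ∅ countable_empty
    (fun i => (contDiff_fluxField hp i).continuous.continuousOn)
    (fun x _ i => ((contDiff_fluxField hp i).differentiable (by simp) x).hasFDerivAt)
    (by
      refine Continuous.integrableOn_Icc ?_
      exact continuous_finsetSum _ fun i _ => (contDiff_pderiv (contDiff_fluxField hp i) i).continuous)
  have h0 : (∫ x in Icc a b, ∑ i, fderiv ℝ (fluxField p i) x (Pi.single i 1)) = 0 := by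
    refine setIntegral_eq_zero_of_forall_eq_zero fun x hxx => ?_
    refine divergence_fluxField hp x (hx x ?_)
    have h1 := hxx.1 0
    have h2 := hxx.2 0
    simp only [a, b, Pi.zero_apply, Fin.cons_zero] at h1 h2
    exact ⟨h1, h2⟩
  rw [h0, Fin.sum_univ_succ] at hdiv
  have hside : ∀ k : Fin 3, ∀ x : Fin 3 → ℝ,
      fluxField p k.succ (k.succ.insertNth (b k.succ) x)
        = fluxField p k.succ (k.succ.insertNth (a k.succ) x) := by
    intro k x
    rw [← fluxField_periodic (fun i x => hper i k x) _ (k.succ.insertNth (a k.succ) x)]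
    congr 1
    funext i
    refine Fin.succAboveCases k.succ ?_ (fun j => ?_) i
    · simp [a, b]
    · simp
  rw [Finset.sum_eq_zero (fun k _ => by simp only [hside, sub_self]), add_zero] at hdiv
  have hdiv' := sub_eq_zero.1 hdiv.symm
  have ha' : a ∘ Fin.succAbove 0 = 0 := by funext i; simp [a]
  have hb' : b ∘ Fin.succAbove 0 = fun _ => 2 * Real.pi := by funext i; simp [b]
  rw [ha', hb'] at hdiv'
  simpa [flux, a, b, Fin.insertNth_zero] using hdiv'

end BorromeanRings

namespace BorromeanRings

open Topology

/-! ### Spinors -/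

/-- The action of a vector of `ℝ³` on `ℂ²` by Pauli matrices. -/
noncomputable def spin (v : E3) (ψ : ℂ × ℂ) : ℂ × ℂ :=
  ((v 2 : ℂ) * ψ.1 + ((v 0 : ℂ) - v 1 * Complex.I) * ψ.2,
    ((v 0 : ℂ) + v 1 * Complex.I) * ψ.1 - (v 2 : ℂ) * ψ.2)

/-- `ψ` is a spinor in the direction of `v`. -/
def IsSpinor (v : E3) (ψ : ℂ × ℂ) : Prop :=
  ψ ≠ 0 ∧ spin v ψ = (‖v‖ : ℂ) • ψ

/-- The area form on `ℂ²`. -/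
def wedge (ψ φ : ℂ × ℂ) : ℂ := ψ.1 * φ.2 - ψ.2 * φ.1

theorem norm_sq_E3 (v : E3) : ‖v‖ ^ 2 = v 0 ^ 2 + v 1 ^ 2 + v 2 ^ 2 := by
  rw [EuclideanSpace.norm_sq_eq, Fin.sum_univ_three]
  simp

/-- The Clifford relation: the Pauli matrix of `v` squares to ‖v‖². Hence a nonzero vector acts
invertibly. -/
theorem spin_spin (v : E3) (ψ : ℂ × ℂ) : spin v (spin v ψ) = ((‖v‖ : ℂ) ^ 2) • ψ := by
  have h : (‖v‖ : ℂ) ^ 2 = (v 0 : ℂ) ^ 2 + (v 1 : ℂ) ^ 2 + (v 2 : ℂ) ^ 2 := by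
    exact_mod_cast congrArg (fun r : ℝ => (r : ℂ)) (norm_sq_E3 v)
  rw [h]
  ext <;> simp only [spin, Prod.smul_fst, Prod.smul_snd, smul_eq_mul]
  · linear_combination (-(v 1 : ℂ) ^ 2 * ψ.1) * Complex.I_sq
  · linear_combination (-(v 1 : ℂ) ^ 2 * ψ.2) * Complex.I_sq

theorem spin_add (v w : E3) (ψ : ℂ × ℂ) : spin (v + w) ψ = spin v ψ + spin w ψ := by
  ext <;> simp [spin] <;> ring

theorem spin_smul_left (a : ℝ) (v : E3) (ψ : ℂ × ℂ) : spin (a • v) ψ = (a : ℂ) • spin v ψ := by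
  ext <;> simp [spin] <;> ring

theorem spin_smul_right (a : ℂ) (v : E3) (ψ : ℂ × ℂ) : spin v (a • ψ) = a • spin v ψ := by
  ext <;> simp [spin] <;> ring

theorem spin_add_right (v : E3) (ψ φ : ℂ × ℂ) : spin v (ψ + φ) = spin v ψ + spin v φ := by
  ext <;> simp [spin] <;> ring

theorem spin_eq_zero {v : E3} {ψ : ℂ × ℂ} (h : spin v ψ = 0) (hψ : ψ ≠ 0) : v = 0 := by
  have h2 := spin_spin v ψ
  rw [h] at h2
  have h0 : spin v 0 = 0 := by ext <;> simp [spin]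
  rw [h0] at h2
  have := (smul_eq_zero.1 h2.symm).resolve_right hψ
  simpa using this

/-- Proportional spinors span a common eigenline, on which ‖v‖w - ‖w‖v acts as zero. A vector that
kills a nonzero spinor is zero. -/
theorem sameRay_of_wedge_eq_zero {v w : E3} {ψ φ : ℂ × ℂ} (hψ : IsSpinor v ψ)
    (hφ : IsSpinor w φ) (h : wedge ψ φ = 0) : SameRay ℝ v w := by
  obtain ⟨c, hc⟩ : ∃ c : ℂ, φ = c • ψ := by
    unfold wedge at h
    by_cases h1 : ψ.1 = 0
    · have h2 : ψ.2 ≠ 0 := fun h2 => hψ.1 (Prod.ext h1 h2)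
      refine ⟨φ.2 / ψ.2, Prod.ext ?_ ?_⟩
      · simp only [h1, zero_mul, zero_sub, neg_eq_zero, mul_eq_zero, h2, false_or] at h
        simp [h, h1]
      · simp [h2]
    · refine ⟨φ.1 / ψ.1, Prod.ext ?_ ?_⟩
      · simp [h1]
      · simp only [Prod.smul_snd, smul_eq_mul]
        field_simp
        linear_combination h
  have hc0 : c ≠ 0 := by
    rintro rfl
    exact hφ.1 (by simp [hc])
  have hw : spin w ψ = (‖w‖ : ℂ) • ψ := by
    have := hφ.2
    rw [hc, spin_smul_right, smul_comm] at this
    exact smul_right_injective _ hc0 this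
  rw [sameRay_iff_norm_smul_eq, ← sub_eq_zero]
  refine spin_eq_zero (ψ := ψ) ?_ hψ.1
  rw [sub_eq_add_neg, ← neg_smul, spin_add, spin_smul_left, spin_smul_left, hw, hψ.2]
  ext <;> simp <;> ring

/-- Transport of a spinor from the direction of `v` to the direction of `w`. -/
noncomputable def transport (v w : E3) (ψ : ℂ × ℂ) : ℂ × ℂ :=
  (2 * ‖v‖ : ℂ)⁻¹ • ((‖w‖ : ℂ) • ψ + spin w ψ)

theorem transport_self {v : E3} {ψ : ℂ × ℂ} (hv : v ≠ 0) (hψ : IsSpinor v ψ) :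
    transport v v ψ = ψ := by
  have : (‖v‖ : ℂ) ≠ 0 := by simpa using hv
  rw [transport, hψ.2, ← two_smul ℂ ((‖v‖ : ℂ) • ψ), smul_smul, smul_smul]
  rw [show ((2 * ‖v‖ : ℂ)⁻¹ * 2 * (‖v‖ : ℂ)) = 1 by field_simp, one_smul]

/-- Up to a scalar, `transport` is the spectral projection to the eigenline of `w`. It kills ψ only
if ‖v‖w + ‖w‖v does, that is, only if this vector vanishes: `w` is zero or opposite to `v`. -/
theorem isSpinor_transport {v w : E3} {ψ : ℂ × ℂ} (hv : v ≠ 0) (hψ : IsSpinor v ψ)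
    (h : ‖v‖ • w + ‖w‖ • v ≠ 0) : IsSpinor w (transport v w ψ) := by
  have hv' : (‖v‖ : ℂ) ≠ 0 := by simpa using hv
  constructor
  · intro h0
    have h1 := (smul_eq_zero.1 h0).resolve_left (by simpa using hv)
    apply h
    refine spin_eq_zero (ψ := ψ) ?_ hψ.1
    rw [spin_add, spin_smul_left, spin_smul_left, hψ.2, smul_comm, ← smul_add, add_comm, h1,
      smul_zero]
  · rw [transport, spin_smul_right, spin_add_right, spin_smul_right, spin_spin, smul_comm]
    congr 1
    rw [smul_add, smul_smul, pow_two, add_comm]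

theorem continuous_spin : Continuous fun q : E3 × (ℂ × ℂ) => spin q.1 q.2 := by
  unfold spin
  fun_prop

/-- Three nonzero vectors which do not all have the same direction. -/
def Admissible (v : Fin 3 → E3) : Prop :=
  (∀ i, v i ≠ 0) ∧ ¬ (SameRay ℝ (v 0) (v 1) ∧ SameRay ℝ (v 1) (v 2))

/-- The nonzero vectors of `ℂ²`. -/
abbrev Punctured : Type := {p : ℂ × ℂ // p ≠ 0}

theorem wedge_ne_zero {v : Fin 3 → E3} (hv : Admissible v) {ψ : Fin 3 → ℂ × ℂ}
    (hψ : ∀ i, IsSpinor (v i) (ψ i)) : (wedge (ψ 0) (ψ 1), wedge (ψ 1) (ψ 2)) ≠ 0 := by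
  intro h
  rw [Prod.mk_eq_zero] at h
  exact hv.2 ⟨sameRay_of_wedge_eq_zero (hψ 0) (hψ 1) h.1, sameRay_of_wedge_eq_zero (hψ 1) (hψ 2) h.2⟩

variable {K : Type*} [TopologicalSpace K]

/-- `F` is the map to `ℂ² ∖ 0` defined by some choice of spinors for the family `v` of triples
of vectors. -/
def IsSpinorMap (v : K → Fin 3 → E3) (F : C(K, Punctured)) : Prop :=
  ∃ ψ : K → Fin 3 → ℂ × ℂ, Continuous ψ ∧ (∀ k i, IsSpinor (v k i) (ψ k i)) ∧
    ∀ k, (F k : ℂ × ℂ) = (wedge (ψ k 0) (ψ k 1), wedge (ψ k 1) (ψ k 2))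

/-- As long as no vector becomes opposite to its position at time `τ`, all spinors can be projected
directly from time `τ`, and this is continuous in time. -/
theorem IsSpinorMap.exists_homotopic_of_ne {V : ℝ → K → Fin 3 → E3}
    (hV : Continuous fun q : ℝ × K => V q.1 q.2) (hadm : ∀ τ k, Admissible (V τ k)) {τ τ' : ℝ}
    (h : ∀ t ∈ segment ℝ τ τ', ∀ k i, ‖V τ k i‖ • V t k i + ‖V t k i‖ • V τ k i ≠ 0)
    {F : C(K, Punctured)} (hF : IsSpinorMap (V τ) F) :
    ∃ F' : C(K, Punctured), IsSpinorMap (V τ') F' ∧ F.Homotopic F' := by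
  obtain ⟨ψ, hψc, hψ, hFψ⟩ := hF
  have hseg : ∀ t : unitInterval, τ + t * (τ' - τ) ∈ segment ℝ τ τ' := fun t => by
    rw [segment_eq_image']
    exact ⟨t, t.2, by simp⟩
  set Ψ : unitInterval × K → Fin 3 → ℂ × ℂ := fun q i =>
    transport (V τ q.2 i) (V (τ + q.1 * (τ' - τ)) q.2 i) (ψ q.2 i) with hΨ
  have hspin : ∀ q i, IsSpinor (V (τ + q.1 * (τ' - τ)) q.2 i) (Ψ q i) := fun q i =>
    isSpinor_transport ((hadm _ _).1 i) (hψ _ _) (h _ (hseg q.1) _ _)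
  have hΨc : Continuous Ψ := by
    refine continuous_pi fun i => ?_
    have h1 : Continuous fun q : unitInterval × K => V τ q.2 i :=
      (continuous_apply i).comp (hV.comp (continuous_const.prodMk continuous_snd))
    have hγ : Continuous fun q : unitInterval × K => (τ + (q.1 : ℝ) * (τ' - τ), q.2) := by
      fun_prop
    have h2 : Continuous fun q : unitInterval × K => V (τ + q.1 * (τ' - τ)) q.2 i :=
      (continuous_apply i).comp (hV.comp hγ)
    have h3 : Continuous fun q : unitInterval × K => ψ q.2 i :=
      (continuous_apply i).comp (hψc.comp continuous_snd)
    have h4 : Continuous fun q : unitInterval × K => (2 * ‖V τ q.2 i‖ : ℂ)⁻¹ := by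
      refine Continuous.inv₀ (by fun_prop) fun q => ?_
      simpa using (hadm τ q.2).1 i
    have h5 := continuous_spin.comp (h2.prodMk h3)
    have h6 : Continuous fun q : unitInterval × K =>
        (‖V (τ + q.1 * (τ' - τ)) q.2 i‖ : ℂ) • ψ q.2 i :=
      Continuous.smul (Complex.continuous_ofReal.comp h2.norm) h3
    exact h4.smul (h6.add h5)
  let H : C(unitInterval × K, Punctured) :=
    ⟨fun q => ⟨(wedge (Ψ q 0) (Ψ q 1), wedge (Ψ q 1) (Ψ q 2)),
      wedge_ne_zero (hadm _ _) (hspin q)⟩, by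
        refine Continuous.subtype_mk ?_ _
        unfold wedge
        fun_prop⟩
  refine ⟨H.comp ⟨fun k => ((1 : unitInterval), k), by fun_prop⟩, ⟨fun k => Ψ (1, k), hΨc.comp (by fun_prop), fun k i => ?_,
    fun k => rfl⟩, ⟨⟨H, fun k => ?_, fun k => rfl⟩⟩⟩
  · simpa using hspin (1, k) i
  · have h0 : ∀ i, Ψ (0, k) i = ψ k i := fun i => by
      simp only [hΨ, Icc.coe_zero, zero_mul, add_zero]
      exact transport_self ((hadm _ _).1 i) (hψ k i)
    refine Subtype.ext ?_
    rw [hFψ]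
    simp [H, h0]

/-- Compactness of `K` makes direct transport possible between any two times near a given one. The
relation is transitive, so connectedness of ℝ extends it to all times. -/
theorem IsSpinorMap.exists_homotopic [CompactSpace K] {V : ℝ → K → Fin 3 → E3}
    (hV : Continuous fun q : ℝ × K => V q.1 q.2) (hadm : ∀ τ k, Admissible (V τ k)) (τ τ' : ℝ)
    {F : C(K, Punctured)} (hF : IsSpinorMap (V τ) F) :
    ∃ F' : C(K, Punctured), IsSpinorMap (V τ') F' ∧ F.Homotopic F' := by
  let P : ℝ → ℝ → Prop := fun τ τ' => ∀ F : C(K, Punctured), IsSpinorMap (V τ) F →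
    ∃ F' : C(K, Punctured), IsSpinorMap (V τ') F' ∧ F.Homotopic F'
  suffices P τ τ' from this F hF
  have htrans : IsTrans ℝ P := ⟨fun a b c hab hbc F hF => by
    obtain ⟨F', h1, h2⟩ := hab F hF
    obtain ⟨F'', h3, h4⟩ := hbc F' h1
    exact ⟨F'', h3, h2.trans h4⟩⟩
  refine PreconnectedSpace.induction₂' P (fun τ₀ => ?_) htrans τ τ'
  have hopen : ∀ᶠ s : ℝ × ℝ in 𝓝 (τ₀, τ₀), ∀ k ∈ (univ : Set K), ∀ i,
      ‖V s.1 k i‖ • V s.2 k i + ‖V s.2 k i‖ • V s.1 k i ≠ 0 := by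
    refine isCompact_univ.eventually_forall_of_forall_eventually fun k _ => ?_
    rw [Filter.eventually_all]
    intro i
    have hc : Continuous fun q : (ℝ × ℝ) × K =>
        ‖V q.1.1 q.2 i‖ • V q.1.2 q.2 i + ‖V q.1.2 q.2 i‖ • V q.1.1 q.2 i := by
      have h1 : Continuous fun q : (ℝ × ℝ) × K => V q.1.1 q.2 i :=
        (continuous_apply i).comp (hV.comp (by fun_prop : Continuous fun q : (ℝ × ℝ) × K =>
          (q.1.1, q.2)))
      have h2 : Continuous fun q : (ℝ × ℝ) × K => V q.1.2 q.2 i :=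
        (continuous_apply i).comp (hV.comp (by fun_prop : Continuous fun q : (ℝ × ℝ) × K =>
          (q.1.2, q.2)))
      fun_prop
    refine hc.continuousAt.eventually_ne ?_
    have h0 := (hadm τ₀ k).1 i
    simpa [← two_smul ℝ (‖V τ₀ k i‖ • V τ₀ k i)] using h0
  obtain ⟨ε, hε, hball⟩ := Metric.eventually_nhds_iff_ball.1 hopen
  have key : ∀ a ∈ Metric.ball τ₀ ε, ∀ b ∈ Metric.ball τ₀ ε, P a b := by
    intro a ha b hb F hF
    refine IsSpinorMap.exists_homotopic_of_ne hV hadm (fun t ht k i => ?_) hF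
    have ht' := (convex_ball τ₀ ε).segment_subset ha hb ht
    exact hball (a, t) (by rw [← ball_prod_same]; exact ⟨ha, ht'⟩) k (mem_univ _) i
  filter_upwards [Metric.ball_mem_nhds τ₀ hε] with b hb
  exact ⟨key _ (Metric.mem_ball_self hε) _ hb, key _ hb _ (Metric.mem_ball_self hε)⟩

end BorromeanRings

namespace BorromeanRings

open MeasureTheory

/-! ### The standard map of the three-torus and its flux -/

theorem pderiv_eq_of_hasFDerivAt {p : (Fin 4 → ℝ) → ℝ} {p' : (Fin 4 → ℝ) →L[ℝ] ℝ} {x : Fin 4 → ℝ}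
    (h : HasFDerivAt p p' x) (j : Fin 4) : pderiv j p x = p' (Pi.single j 1) := by
  rw [pderiv, h.fderiv]

theorem pderiv_comp {q q' : ℝ → ℝ} {p : (Fin 4 → ℝ) → ℝ} (hq : ∀ t, HasDerivAt q (q' t) t)
    {x : Fin 4 → ℝ} (hp : DifferentiableAt ℝ p x) (j : Fin 4) :
    pderiv j (fun x => q (p x)) x = q' (p x) * pderiv j p x := by
  have h : HasFDerivAt (fun x => q (p x)) (q' (p x) • fderiv ℝ p x) x :=
    (hq (p x)).comp_hasFDerivAt x hp.hasFDerivAt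
  rw [pderiv_eq_of_hasFDerivAt h]
  rfl

theorem pderiv_congr {p q : (Fin 4 → ℝ) → ℝ} {x : Fin 4 → ℝ} (hp : DifferentiableAt ℝ p x)
    (hq : DifferentiableAt ℝ q x) (j : Fin 4)
    (h : ∀ t : ℝ, p (x + t • Pi.single j 1) = q (x + t • Pi.single j 1)) :
    pderiv j p x = pderiv j q x := by
  rw [pderiv, pderiv, ← hp.lineDeriv_eq_fderiv, ← hq.lineDeriv_eq_fderiv, lineDeriv, lineDeriv]
  simp only [h]

/-- The flux involves only derivatives along the torus, so agreement on the slice at time `τ` is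
enough. -/
theorem flux_congr {p q : Fin 4 → (Fin 4 → ℝ) → ℝ} (hp : ∀ i, ContDiff ℝ ∞ (p i))
    (hq : ∀ i, ContDiff ℝ ∞ (q i)) {τ : ℝ} (h : ∀ i x, x 0 = τ → p i x = q i x) :
    flux p τ = flux q τ := by
  unfold flux
  congr 1
  funext x
  have hd : ∀ i (j : Fin 3), pderiv j.succ (p i) (Fin.cons τ x) = pderiv j.succ (q i) (Fin.cons τ x) :=
    fun i j => pderiv_congr ((hp i).differentiable (by simp) _) ((hq i).differentiable (by simp) _) _
      fun t => h _ _ (by simp)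
  have d1 := fun i => hd i 0
  have d2 := fun i => hd i 1
  have d3 := fun i => hd i 2
  simp only [Fin.succ_zero_eq_one, Fin.succ_one_eq_two, Fin.reduceSucc] at d1 d2 d3
  simp only [fluxField, jac, Matrix.cons_val_zero, d1, d2, d3]
  rw [h 0 _ (by simp)]

theorem flux_eq_zero_of_const {p : Fin 4 → (Fin 4 → ℝ) → ℝ} (hp : ∀ i, ContDiff ℝ ∞ (p i)) {τ : ℝ}
    {c : Fin 4 → ℝ} (h : ∀ i x, x 0 = τ → p i x = c i) : flux p τ = 0 := by
  rw [flux_congr hp (q := fun i _ => c i) (fun i => contDiff_const) h]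
  simp [flux, fluxField, jac, pderiv]

/-- A smooth bump function at the origin. -/
noncomputable def bump (ε t : ℝ) : ℝ := Real.smoothTransition (1 - (t / ε) ^ 2)

theorem contDiff_bump (ε : ℝ) : ContDiff ℝ ∞ (bump ε) := by
  unfold bump
  exact Real.smoothTransition.contDiff.comp (by fun_prop)

theorem bump_nonneg (ε t : ℝ) : 0 ≤ bump ε t := Real.smoothTransition.nonneg _

theorem bump_zero (ε : ℝ) : bump ε 0 = 1 := by simp [bump]

theorem bump_eq_zero {ε t : ℝ} (hε : 0 < ε) (h : ε ≤ |t|) : bump ε t = 0 := by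
  refine Real.smoothTransition.zero_of_nonpos ?_
  rw [sub_nonpos, ← sq_abs, abs_div, abs_of_pos hε]
  exact one_le_pow₀ ((one_le_div hε).2 h)

/-- A primitive of the bump function. -/
noncomputable def bumpPrimitive (ε t : ℝ) : ℝ := ∫ s in (0 : ℝ)..t, bump ε s

theorem hasDerivAt_bumpPrimitive (ε t : ℝ) : HasDerivAt (bumpPrimitive ε) (bump ε t) t :=
  ((contDiff_bump ε).continuous).integral_hasStrictDerivAt 0 t |>.hasDerivAt

theorem contDiff_bumpPrimitive (ε : ℝ) : ContDiff ℝ ∞ (bumpPrimitive ε) := by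
  rw [contDiff_infty_iff_deriv]
  refine ⟨fun t => (hasDerivAt_bumpPrimitive ε t).differentiableAt, ?_⟩
  rw [show deriv (bumpPrimitive ε) = bump ε from
    funext fun t => (hasDerivAt_bumpPrimitive ε t).deriv]
  exact contDiff_bump ε

/-- Functions of the four real coordinates `Re c₂, Re c₁, Im c₁, Im c₂` on `ℂ²`: the closed form
`dq₁ ∧ dq₂ ∧ dq₃` multiplied by `q₀` is supported near the negative half-axis of `Re c₂`. -/
noncomputable def testFun (ε : ℝ) : Fin 4 → ℝ → ℝ :=
  ![fun t => Real.smoothTransition (-t / ε), bumpPrimitive ε, bumpPrimitive ε, bumpPrimitive ε]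

theorem contDiff_testFun (ε : ℝ) (i : Fin 4) : ContDiff ℝ ∞ (testFun ε i) := by
  have h := contDiff_bumpPrimitive ε
  fin_cases i
  · exact Real.smoothTransition.contDiff.comp (by fun_prop : ContDiff ℝ ∞ fun t : ℝ => -t / ε)
  · exact h
  · exact h
  · exact h

/-- Consequently dq₀ ∧ dq₁ ∧ dq₂ ∧ dq₃ vanishes outside the cube of half-side ε, which is where the
three-form can fail to be closed. -/
theorem deriv_testFun {ε : ℝ} (hε : 0 < ε) (i : Fin 4) {t : ℝ} (ht : ε < |t|) :
    deriv (testFun ε i) t = 0 := by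
  have hB : deriv (bumpPrimitive ε) t = 0 := by
    rw [(hasDerivAt_bumpPrimitive ε t).deriv, bump_eq_zero hε ht.le]
  have h0 : deriv (fun t => Real.smoothTransition (-t / ε)) t = 0 := by
    rcases lt_abs.1 ht with h | h
    · have : (fun t => Real.smoothTransition (-t / ε)) =ᶠ[nhds t] fun _ => 0 := by
        filter_upwards [lt_mem_nhds (hε.trans h)] with s hs
        exact Real.smoothTransition.zero_of_nonpos (div_nonpos_of_nonpos_of_nonneg (by linarith) hε.le)
      rw [this.deriv_eq, deriv_const]
    · have : (fun t => Real.smoothTransition (-t / ε)) =ᶠ[nhds t] fun _ => 1 := by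
        filter_upwards [gt_mem_nhds (show t < -ε by linarith)] with s hs
        exact Real.smoothTransition.one_of_one_le ((one_le_div hε).2 (by linarith))
      rw [this.deriv_eq, deriv_const]
  fin_cases i
  · exact h0
  · exact hB
  · exact hB
  · exact hB

/-- The real coordinates on `ℂ²`. -/
noncomputable def coord : Fin 4 → ℂ × ℂ → ℝ :=
  ![fun c => c.2.re, fun c => c.1.re, fun c => c.1.im, fun c => c.2.im]

theorem contDiff_coord (i : Fin 4) : ContDiff ℝ ∞ (coord i) := by
  have hre : ContDiff ℝ ∞ Complex.re := Complex.reCLM.contDiff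
  have him : ContDiff ℝ ∞ Complex.im := Complex.imCLM.contDiff
  fin_cases i
  · exact hre.comp contDiff_snd
  · exact hre.comp contDiff_fst
  · exact him.comp contDiff_fst
  · exact him.comp contDiff_snd

theorem norm_le_of_coord {ε : ℝ} {c : ℂ × ℂ} (h : ∀ i, |coord i c| ≤ ε) : ‖c‖ ≤ 2 * ε := by
  have h0 := h 0
  have h1 := h 1
  have h2 := h 2
  have h3 := h 3
  simp only [coord, Matrix.cons_val_zero, Matrix.cons_val_one, Matrix.cons_val] at h0 h1 h2 h3
  rw [Prod.norm_def, sup_le_iff]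
  exact ⟨(Complex.norm_le_abs_re_add_abs_im _).trans (by linarith),
    (Complex.norm_le_abs_re_add_abs_im _).trans (by linarith)⟩

/-- The standard map of the three-torus to `ℂ² ∖ 0`. -/
noncomputable def stdFun (k : Circle × Circle × Circle) : ℂ × ℂ :=
  ((1 - k.2.1 * k.2.2) + Complex.I * (k.2.2 - k.2.1),
    (1 + k.2.2) - Complex.I * k.1 * (1 - k.2.2))

/-- The universal covering of the three-torus, not depending on the zeroth coordinate. -/
noncomputable def torusExp (θ : Fin 4 → ℝ) : Circle × Circle × Circle :=
  (Circle.exp (θ 1), Circle.exp (θ 2), Circle.exp (θ 3))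

theorem coord_stdFun (θ : Fin 4 → ℝ) :
    coord 0 (stdFun (torusExp θ)) = 1 + Real.cos (θ 3) + Real.sin (θ 1) - Real.sin (θ 1 + θ 3) ∧
    coord 1 (stdFun (torusExp θ)) =
      1 - Real.cos (θ 2 + θ 3) - Real.sin (θ 3) + Real.sin (θ 2) ∧
    coord 2 (stdFun (torusExp θ)) = - Real.sin (θ 2 + θ 3) + Real.cos (θ 3) - Real.cos (θ 2) ∧
    coord 3 (stdFun (torusExp θ)) = Real.sin (θ 3) - Real.cos (θ 1) + Real.cos (θ 1 + θ 3) := by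
  refine ⟨?_, ?_, ?_, ?_⟩ <;>
    simp [coord, stdFun, torusExp, Complex.exp_ofReal_mul_I_re, Complex.exp_ofReal_mul_I_im,
      Real.cos_add, Real.sin_add] <;> ring

theorem contDiff_stdFun : ContDiff ℝ ∞ fun θ => stdFun (torusExp θ) := by
  unfold stdFun torusExp
  simp only [Circle.coe_exp]
  have h : ∀ i : Fin 4, ContDiff ℝ ∞ fun θ : Fin 4 → ℝ => Complex.exp (θ i * Complex.I) := fun i =>
    ((Complex.ofRealCLM.contDiff.comp (contDiff_apply ℝ ℝ i)).mul contDiff_const).cexp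
  have h1 := h 1
  have h2 := h 2
  have h3 := h 3
  fun_prop

/-- On the support of the test functions the two relevant Jacobians have definite signs. -/
theorem std_sign {x y z : ℝ} (hm : 1 + Real.cos z + Real.sin x - Real.sin (x + z) ≤ 0)
    (ha : |1 - Real.cos (y + z) - Real.sin z + Real.sin y| ≤ 1 / 100)
    (hb : |- Real.sin (y + z) + Real.cos z - Real.cos y| ≤ 1 / 100) :
    0 ≤ - (Real.cos y + Real.cos z) + Real.sin (y - z) := by
  have ha2 := sq_le_sq' (abs_le.1 ha).1 (abs_le.1 ha).2
  have hb2 := sq_le_sq' (abs_le.1 hb).1 (abs_le.1 hb).2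
  have hy := Real.sin_sq_add_cos_sq y
  have hz := Real.sin_sq_add_cos_sq z
  have hx := Real.sin_sq_add_cos_sq x
  have hy1 := Real.cos_le_one y
  -- The two numbers are the real and imaginary part of the first component of `stdFun`. If both are
  -- small, then y + z and y - z are both close to 0 modulo 2π.
  have hsum : (1 - Real.cos (y + z) - Real.sin z + Real.sin y) ^ 2
      + (- Real.sin (y + z) + Real.cos z - Real.cos y) ^ 2
      = (2 - 2 * Real.cos (y + z)) + (2 - 2 * Real.cos (y - z)) := by
    rw [Real.cos_add, Real.sin_add, Real.cos_sub]
    grind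
  have hp1 := Real.cos_le_one (y + z)
  have hq1 := Real.cos_le_one (y - z)
  set P := Real.cos (y + z)
  set Q := Real.cos (y - z) with hQ
  have hP : 1 - 1 / 10000 ≤ P := by linarith
  have hQ' : 1 - 1 / 10000 ≤ Q := by linarith
  have hcc : (Real.cos y + Real.cos z) ^ 2 = (1 + P) * (1 + Q) := by
    simp only [P, Q, Real.cos_add, Real.cos_sub]
    grind
  have hcc' : (2 - 1 / 10000) ^ 2 ≤ (Real.cos y + Real.cos z) ^ 2 := by
    rw [hcc, pow_two]
    exact mul_le_mul (by linarith) (by linarith) (by norm_num) (by linarith)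
  have hs := Real.sin_sq_add_cos_sq (y - z)
  rw [← hQ] at hs
  have hQ2 : (1 - 1 / 10000) ^ 2 ≤ Q ^ 2 := pow_le_pow_left₀ (by norm_num) hQ' 2
  have hs' := abs_le_of_sq_le_sq (a := Real.sin (y - z)) (b := 1 / 50) (by linarith) (by norm_num)
  have habs := sq_le_sq.1 hcc'
  rw [abs_of_pos (by norm_num)] at habs
  -- Now cos y and cos z are both near -1 or both near 1. In the second case the left side of `hm`
  -- is close to 2, a contradiction.
  rcases le_or_gt (Real.cos y + Real.cos z) 0 with h | h
  · rw [abs_of_nonpos h] at habs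
    linarith [(abs_le.1 hs').1]
  · exfalso
    rw [abs_of_pos h] at habs
    have hz1 : 1 - 1 / 10000 ≤ Real.cos z := by linarith
    have hz2 := Real.cos_le_one z
    have hz3 : (1 - 1 / 10000) ^ 2 ≤ Real.cos z ^ 2 := pow_le_pow_left₀ (by norm_num) hz1 2
    have hsz := abs_le_of_sq_le_sq (a := Real.sin z) (b := 1 / 50) (by linarith) (by norm_num)
    rw [Real.sin_add] at hm
    have hcs : Real.cos x * Real.sin z ≤ 1 / 50 := by
      refine (le_abs_self _).trans ?_
      rw [abs_mul]
      exact (mul_le_of_le_one_left (abs_nonneg _) (Real.abs_cos_le_one x)).trans hsz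
    have hsx := mul_nonneg (neg_le_iff_add_nonneg.1 (Real.neg_one_le_sin x)) (sub_nonneg.2 hz2)
    linarith

end BorromeanRings

/-! ### The sign of the flux of the standard map -/

namespace BorromeanRings

open MeasureTheory

/-- The test functions composed with a family of maps to `ℂ²`. -/
noncomputable def testComp (ε : ℝ) (F : (Fin 4 → ℝ) → ℂ × ℂ) (i : Fin 4) (θ : Fin 4 → ℝ) : ℝ :=
  testFun ε i (coord i (F θ))

theorem contDiff_testComp {ε : ℝ} {F : (Fin 4 → ℝ) → ℂ × ℂ} (hF : ContDiff ℝ ∞ F) (i : Fin 4) :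
    ContDiff ℝ ∞ (testComp ε F i) :=
  (contDiff_testFun ε i).comp ((contDiff_coord i).comp hF)

/-- The first component of `stdFun` does not depend on θ₁. So the Jacobian is the θ₁-derivative of
the last coordinate times a 2 × 2 minor in θ₂, θ₃. -/
theorem fluxField_std (ε : ℝ) (θ : Fin 4 → ℝ) :
    fluxField (testComp ε fun θ => stdFun (torusExp θ)) 0 θ =
      Real.smoothTransition (-(1 + Real.cos (θ 3) + Real.sin (θ 1) - Real.sin (θ 1 + θ 3)) / ε) *
      (bump ε (1 - Real.cos (θ 2 + θ 3) - Real.sin (θ 3) + Real.sin (θ 2)) *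
        bump ε (- Real.sin (θ 2 + θ 3) + Real.cos (θ 3) - Real.cos (θ 2)) *
        bump ε (Real.sin (θ 3) - Real.cos (θ 1) + Real.cos (θ 1 + θ 3))) *
      ((Real.sin (θ 1) - Real.sin (θ 1 + θ 3)) *
        (- (Real.cos (θ 2) + Real.cos (θ 3)) + Real.sin (θ 2 - θ 3))) := by
  have e0 : testComp ε (fun θ => stdFun (torusExp θ)) 0 = fun θ : Fin 4 → ℝ =>
      Real.smoothTransition
        (-(1 + Real.cos (θ 3) + Real.sin (θ 1) - Real.sin (θ 1 + θ 3)) / ε) := by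
    funext θ; rw [testComp, (coord_stdFun θ).1]; rfl
  have e1 : testComp ε (fun θ => stdFun (torusExp θ)) 1 = fun θ : Fin 4 → ℝ =>
      bumpPrimitive ε (1 - Real.cos (θ 2 + θ 3) - Real.sin (θ 3) + Real.sin (θ 2)) := by
    funext θ; rw [testComp, (coord_stdFun θ).2.1]; rfl
  have e2 : testComp ε (fun θ => stdFun (torusExp θ)) 2 = fun θ : Fin 4 → ℝ =>
      bumpPrimitive ε (- Real.sin (θ 2 + θ 3) + Real.cos (θ 3) - Real.cos (θ 2)) := by
    funext θ; rw [testComp, (coord_stdFun θ).2.2.1]; rfl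
  have e3 : testComp ε (fun θ => stdFun (torusExp θ)) 3 = fun θ : Fin 4 → ℝ =>
      bumpPrimitive ε (Real.sin (θ 3) - Real.cos (θ 1) + Real.cos (θ 1 + θ 3)) := by
    funext θ; rw [testComp, (coord_stdFun θ).2.2.2]; rfl
  have x1 := hasFDerivAt_apply (𝕜 := ℝ) (F' := fun _ : Fin 4 => ℝ) 1 θ
  have x2 := hasFDerivAt_apply (𝕜 := ℝ) (F' := fun _ : Fin 4 => ℝ) 2 θ
  have x3 := hasFDerivAt_apply (𝕜 := ℝ) (F' := fun _ : Fin 4 => ℝ) 3 θ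
  have ha : HasFDerivAt (fun θ : Fin 4 → ℝ =>
      1 - Real.cos (θ 2 + θ 3) - Real.sin (θ 3) + Real.sin (θ 2)) _ θ :=
    (((x2.add x3).cos.const_sub 1).sub x3.sin).add x2.sin
  have hb : HasFDerivAt (fun θ : Fin 4 → ℝ =>
      - Real.sin (θ 2 + θ 3) + Real.cos (θ 3) - Real.cos (θ 2)) _ θ :=
    ((x2.add x3).sin.neg.add x3.cos).sub x2.cos
  have hn : HasFDerivAt (fun θ : Fin 4 → ℝ =>
      Real.sin (θ 3) - Real.cos (θ 1) + Real.cos (θ 1 + θ 3)) _ θ :=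
    (x3.sin.sub x1.cos).add (x1.add x3).cos
  simp only [fluxField, Matrix.cons_val_zero, jac, e0, e1, e2, e3]
  rw [pderiv_comp (hasDerivAt_bumpPrimitive ε) ha.differentiableAt,
    pderiv_comp (hasDerivAt_bumpPrimitive ε) ha.differentiableAt,
    pderiv_comp (hasDerivAt_bumpPrimitive ε) ha.differentiableAt,
    pderiv_comp (hasDerivAt_bumpPrimitive ε) hb.differentiableAt,
    pderiv_comp (hasDerivAt_bumpPrimitive ε) hb.differentiableAt,
    pderiv_comp (hasDerivAt_bumpPrimitive ε) hb.differentiableAt,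
    pderiv_comp (hasDerivAt_bumpPrimitive ε) hn.differentiableAt,
    pderiv_comp (hasDerivAt_bumpPrimitive ε) hn.differentiableAt,
    pderiv_comp (hasDerivAt_bumpPrimitive ε) hn.differentiableAt]
  simp only [pderiv_eq_of_hasFDerivAt ha, pderiv_eq_of_hasFDerivAt hb, pderiv_eq_of_hasFDerivAt hn]
  have hJ : (Real.sin (θ 2 + θ 3) + Real.cos (θ 2)) * (-Real.cos (θ 2 + θ 3) + -Real.sin (θ 3))
      - (Real.sin (θ 2 + θ 3) - Real.cos (θ 3)) * (-Real.cos (θ 2 + θ 3) + Real.sin (θ 2))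
      = -Real.cos (θ 3) + -Real.cos (θ 2) + Real.sin (θ 2 - θ 3) := by
    have h2 := Real.sin_sq_add_cos_sq (θ 2)
    have h3 := Real.sin_sq_add_cos_sq (θ 3)
    rw [Real.cos_add, Real.sin_add, Real.sin_sub]
    linear_combination (-Real.cos (θ 3)) * h2 + (-Real.cos (θ 2)) * h3
  simp
  linear_combination (Real.smoothTransition
      ((Real.sin (θ 1 + θ 3) - (1 + Real.cos (θ 3) + Real.sin (θ 1))) / ε) *
      (bump ε (1 - Real.cos (θ 2 + θ 3) - Real.sin (θ 3) + Real.sin (θ 2)) *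
        bump ε (- Real.sin (θ 2 + θ 3) + Real.cos (θ 3) - Real.cos (θ 2)) *
        bump ε (Real.sin (θ 3) - Real.cos (θ 1) + Real.cos (θ 1 + θ 3))) *
      (Real.sin (θ 1) - Real.sin (θ 1 + θ 3))) * hJ

theorem fluxField_std_nonpos {ε : ℝ} (hε : 0 < ε) (hε' : ε ≤ 1 / 100) (θ : Fin 4 → ℝ) :
    fluxField (testComp ε fun θ => stdFun (torusExp θ)) 0 θ ≤ 0 := by
  rw [fluxField_std]
  by_cases hm : 1 + Real.cos (θ 3) + Real.sin (θ 1) - Real.sin (θ 1 + θ 3) ≤ 0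
  swap
  · rw [Real.smoothTransition.zero_of_nonpos
      (div_nonpos_of_nonpos_of_nonneg (by linarith) hε.le)]
    simp
  by_cases ha : |1 - Real.cos (θ 2 + θ 3) - Real.sin (θ 3) + Real.sin (θ 2)| ≤ 1 / 100
  swap
  · rw [bump_eq_zero hε (by linarith)]
    simp
  by_cases hb : |- Real.sin (θ 2 + θ 3) + Real.cos (θ 3) - Real.cos (θ 2)| ≤ 1 / 100
  swap
  · rw [bump_eq_zero hε (t := - Real.sin (θ 2 + θ 3) + Real.cos (θ 3) - Real.cos (θ 2))
      (by linarith)]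
    simp
  refine mul_nonpos_of_nonneg_of_nonpos (mul_nonneg (Real.smoothTransition.nonneg _) ?_)
    (mul_nonpos_of_nonpos_of_nonneg ?_ (std_sign hm ha hb))
  · exact mul_nonneg (mul_nonneg (bump_nonneg _ _) (bump_nonneg _ _)) (bump_nonneg _ _)
  -- By `hm`, sin θ₁ - sin(θ₁ + θ₃) ≤ -(1 + cos θ₃).
  · linarith [Real.neg_one_le_cos (θ 3)]

theorem flux_std_neg {ε : ℝ} (hε : 0 < ε) (hε' : ε ≤ 1 / 100) (τ : ℝ) :
    flux (testComp ε fun θ => stdFun (torusExp θ)) τ < 0 := by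
  have hpi := Real.pi_pos
  set f : (Fin 3 → ℝ) → ℝ := fun x =>
    - fluxField (testComp ε fun θ => stdFun (torusExp θ)) 0 (Fin.cons τ x) with hf
  have hfc : Continuous f :=
    ((contDiff_fluxField (contDiff_testComp contDiff_stdFun) 0).continuous.comp
      (Continuous.finCons continuous_const continuous_id)).neg
  have hf0 : ∀ x, 0 ≤ f x := fun x => neg_nonneg.2 (fluxField_std_nonpos hε hε' _)
  suffices 0 < ∫ x in Icc (0 : Fin 3 → ℝ) (fun _ => 2 * Real.pi), f x by
    simp only [hf, integral_neg, Left.neg_pos_iff] at this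
    exact this
  rw [setIntegral_pos_iff_support_of_nonneg_ae (Filter.Eventually.of_forall hf0)
    hfc.integrableOn_Icc]
  set S : Set (Fin 3 → ℝ) := univ.pi fun _ => Ioo 0 (2 * Real.pi)
  have hS : IsOpen (Function.support f ∩ S) :=
    hfc.isOpen_support.inter (isOpen_set_pi finite_univ fun _ _ => isOpen_Ioo)
  -- At the angles (3π/2, π, π) the standard map has the value (0, -2), on the half-axis that
  -- carries the form. All bumps are 1 there and the Jacobian factor is -4.
  refine (hS.measure_pos volume ⟨![Real.pi / 2 + Real.pi, Real.pi, Real.pi], ?_, ?_⟩).trans_le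
    (measure_mono (inter_subset_inter_right _ fun x hx => ?_))
  · rw [Function.mem_support, hf]
    simp only
    rw [fluxField_std]
    have e1 : (Fin.cons τ ![Real.pi / 2 + Real.pi, Real.pi, Real.pi] : Fin 4 → ℝ) 1
      = Real.pi / 2 + Real.pi := rfl
    have e2 : (Fin.cons τ ![Real.pi / 2 + Real.pi, Real.pi, Real.pi] : Fin 4 → ℝ) 2
      = Real.pi := rfl
    have e3 : (Fin.cons τ ![Real.pi / 2 + Real.pi, Real.pi, Real.pi] : Fin 4 → ℝ) 3
      = Real.pi := rfl
    rw [e1, e2, e3]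
    simp [bump_zero, Real.sin_add, Real.cos_add]
    norm_num
    exact hε
  · intro i _
    fin_cases i <;> simp <;> constructor <;> linarith
  · exact ⟨fun i => (hx i trivial).1.le, fun i => (hx i trivial).2.le⟩

end BorromeanRings

/-! ### From great circles to the Borromean rings -/

namespace BorromeanRings

open scoped Manifold

theorem Admissible.of_forall {v : Fin 3 → E3} (h0 : ∀ i, v i ≠ 0)
    (h : ∀ (n : E3) (a b c : ℝ), 0 < a → 0 < b → 0 < c → v 0 = a • n → v 1 = b • n → v 2 = c • n →
      n = 0) : Admissible v := by
  refine ⟨h0, fun ⟨h1, h2⟩ => h0 1 ?_⟩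
  have p : ∀ i, 0 < ‖v i‖ := fun i => norm_pos_iff.2 (h0 i)
  rw [sameRay_iff_norm_smul_eq] at h1 h2
  refine h (v 1) (‖v 0‖ / ‖v 1‖) 1 (‖v 2‖ / ‖v 1‖) (div_pos (p 0) (p 1)) one_pos
    (div_pos (p 2) (p 1)) ?_ (one_smul _ _).symm ?_
  · rw [div_eq_inv_mul, mul_smul, h1, inv_smul_smul₀ (p 1).ne']
  · rw [div_eq_inv_mul, mul_smul, ← h2, inv_smul_smul₀ (p 1).ne']

/-- A deformation of a triple of great circles, at `r = 0`, to the differences of the components of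
the Borromean rings, at `r = 1`. -/
noncomputable def stdVec (r : ℝ) (k : Circle × Circle × Circle) : Fin 3 → E3 :=
  ![!₂[-(k.2.1 : ℂ).re, 2 * r * (k.1 : ℂ).re, r * (k.1 : ℂ).im - (1 + r) * (k.2.1 : ℂ).im],
    !₂[r * (k.2.1 : ℂ).re - (1 + r) * (k.2.2 : ℂ).re, -(k.2.2 : ℂ).im, 2 * r * (k.2.1 : ℂ).im],
    !₂[2 * r * (k.2.2 : ℂ).re, r * (k.2.2 : ℂ).im - (1 + r) * (k.1 : ℂ).re, -(k.1 : ℂ).im]]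

theorem circle_re_sq_add_im_sq (z : Circle) : (z : ℂ).re ^ 2 + (z : ℂ).im ^ 2 = 1 := by
  have := Circle.normSq_coe z
  rw [Complex.normSq_apply] at this
  linarith

theorem E3_ext {v w : E3} (h0 : v 0 = w 0) (h1 : v 1 = w 1) (h2 : v 2 = w 2) : v = w := by
  ext i
  fin_cases i
  · exact h0
  · exact h1
  · exact h2

/-- If p = 0 then |q| = 1, while |rs| ≤ r < 1 + r. -/
theorem ne_zero_of_ellipse {r p q s t : ℝ} (hr : 0 ≤ r) (h1 : p ^ 2 + q ^ 2 = 1)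
    (h2 : s ^ 2 + t ^ 2 = 1) (hp : p = 0) : r * s - (1 + r) * q ≠ 0 := by
  intro h
  subst hp
  have hs : s ^ 2 ≤ 1 := by nlinarith [sq_nonneg t]
  have hq : q ^ 2 = 1 := by linarith
  have e : (1 + r) ^ 2 * q ^ 2 = r ^ 2 * s ^ 2 := by linear_combination (-r * s - (1 + r) * q) * h
  rw [hq] at e
  nlinarith [mul_le_mul_of_nonneg_left hs (sq_nonneg r)]

theorem admissible_stdVec {r : ℝ} (hr : 0 ≤ r) (k : Circle × Circle × Circle) :
    Admissible (stdVec r k) := by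
  obtain ⟨x, y, z⟩ := k
  have hx := circle_re_sq_add_im_sq x
  have hy := circle_re_sq_add_im_sq y
  have hz := circle_re_sq_add_im_sq z
  refine .of_forall (fun i hi => ?_) fun n a b c ha hb hc h0 h1 h2 => ?_
  · have e0 := congrArg (fun v : E3 => v 0) hi
    have e1 := congrArg (fun v : E3 => v 1) hi
    have e2 := congrArg (fun v : E3 => v 2) hi
    fin_cases i
    · simp [stdVec] at e0 e2
      exact ne_zero_of_ellipse hr hy (by linarith : (x : ℂ).im ^ 2 + (x : ℂ).re ^ 2 = 1) e0 e2
    · simp [stdVec] at e0 e1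
      exact ne_zero_of_ellipse hr (by linarith : (z : ℂ).im ^ 2 + (z : ℂ).re ^ 2 = 1) hy e1 e0
    · simp [stdVec] at e1 e2
      exact ne_zero_of_ellipse hr (by linarith : (x : ℂ).im ^ 2 + (x : ℂ).re ^ 2 = 1)
        (by linarith : (z : ℂ).im ^ 2 + (z : ℂ).re ^ 2 = 1) e2 e1
  · have e (i : Fin 3) := congrArg (fun v : E3 => v i) h0
    have e' (i : Fin 3) := congrArg (fun v : E3 => v i) h1
    have e'' (i : Fin 3) := congrArg (fun v : E3 => v i) h2
    have e0 := e 0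
    have e1 := e 1
    have e2 := e 2
    have e0' := e' 0
    have e1' := e' 1
    have e2' := e' 2
    have e0'' := e'' 0
    have e1'' := e'' 1
    have e2'' := e'' 2
    simp [stdVec] at e0 e1 e2 e0' e1' e2' e0'' e1'' e2''
    -- In each coordinate, the three vectors satisfy a linear relation whose coefficients are 2r,
    -- 2r² and 1 + r in some order; at r = 1 it is twice the relation that their sum is zero. For
    -- positive multiples of a common vector, it forces this vector to vanish.
    have aux : ∀ {t a b c : ℝ}, 0 < a → 0 < b → 0 < c →
        (2 * r * b + 2 * r * r * a + (1 + r) * c) * t = 0 → t = 0 := by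
      intro t a b c ha hb hc h
      refine (mul_eq_zero.1 h).resolve_left (ne_of_gt ?_)
      positivity
    refine E3_ext (aux ha hb hc ?_) (aux hb hc ha ?_) (aux hc ha hb ?_)
    · linear_combination (-2 * r) * e0' + (-(1 + r)) * e0'' + (-2 * r * r) * e0
    · linear_combination (-2 * r) * e1'' + (-(1 + r)) * e1 + (-2 * r * r) * e1'
    · linear_combination (-2 * r) * e2 + (-(1 + r)) * e2' + (-2 * r * r) * e2''

/-- Spinors for the triple of great circles. -/
noncomputable def stdSpinor (k : Circle × Circle × Circle) : Fin 3 → ℂ × ℂ :=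
  ![(k.2.1 - Complex.I, Complex.I * k.2.1 - 1), (1, -k.2.2),
    (1 + Complex.I * k.1, 1 - Complex.I * k.1)]

theorem isSpinor_stdSpinor (k : Circle × Circle × Circle) (i : Fin 3) :
    IsSpinor (stdVec 0 k i) (stdSpinor k i) := by
  obtain ⟨x, y, z⟩ := k
  have hx := circle_re_sq_add_im_sq x
  have hy := circle_re_sq_add_im_sq y
  have hz := circle_re_sq_add_im_sq z
  have hn : ‖stdVec 0 (x, y, z) i‖ = 1 := by
    rw [← sq_eq_sq₀ (norm_nonneg _) one_pos.le, norm_sq_E3]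
    fin_cases i <;> simp [stdVec] <;> linarith
  rw [IsSpinor, hn]
  fin_cases i
  · refine ⟨fun h => ?_, ?_⟩
    · have h1 := congrArg Prod.fst h
      have h2 := congrArg Prod.snd h
      simp [stdSpinor] at h1 h2
      have : (2 : ℂ) = 0 := by linear_combination Complex.I * h1 - h2 + Complex.I_sq
      norm_num at this
    · ext1 <;> apply Complex.ext <;> simp [spin, stdVec, stdSpinor] <;> nlinarith
  · refine ⟨fun h => ?_, ?_⟩
    · have h1 := congrArg Prod.fst h
      simp [stdSpinor] at h1
    · ext1 <;> apply Complex.ext <;> simp [spin, stdVec, stdSpinor] <;> nlinarith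
  · refine ⟨fun h => ?_, ?_⟩
    · have h1 := congrArg Prod.fst h
      have h2 := congrArg Prod.snd h
      simp [stdSpinor] at h1 h2
      have : (2 : ℂ) = 0 := by linear_combination h1 + h2
      norm_num at this
    · ext1 <;> apply Complex.ext <;> simp [spin, stdVec, stdSpinor] <;> nlinarith

theorem stdFun_eq (k : Circle × Circle × Circle) : stdFun k =
    (wedge (stdSpinor k 0) (stdSpinor k 1), wedge (stdSpinor k 1) (stdSpinor k 2)) := by
  ext <;> simp [stdFun, wedge, stdSpinor] <;> ring

theorem stdFun_ne_zero (k : Circle × Circle × Circle) : stdFun k ≠ 0 := by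
  rw [stdFun_eq]
  exact wedge_ne_zero (admissible_stdVec le_rfl k) (isSpinor_stdSpinor k)

/-- The standard map of the three-torus, as a map to `ℂ² ∖ 0`. -/
noncomputable def stdMap : C(Circle × Circle × Circle, Punctured) :=
  ⟨fun k => ⟨stdFun k, stdFun_ne_zero k⟩, by
    refine Continuous.subtype_mk ?_ _
    unfold stdFun
    fun_prop⟩

theorem isSpinorMap_stdMap : IsSpinorMap (stdVec 0) stdMap := by
  refine ⟨stdSpinor, ?_, isSpinor_stdSpinor, stdFun_eq⟩
  refine continuous_pi fun i => ?_
  fin_cases i <;> simp [stdSpinor] <;> constructor <;> fun_prop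

/-! ### The standard map is not null-homotopic -/

theorem exists_smooth_approx {f : (Circle × Circle × Circle) × ℝ → ℂ × ℂ} (hf : Continuous f)
    {ε : ℝ} (hε : 0 < ε) : ∃ g : (Circle × Circle × Circle) × ℝ → ℂ × ℂ,
      (∀ q, dist (g q) (f q) < ε) ∧
      ContDiff ℝ ∞ fun q : (Fin 4 → ℝ) × ℝ => g (torusExp q.1, q.2) := by
  obtain ⟨g, hg, -⟩ := hf.exists_contMDiff_approx
    (((𝓡 1).prod ((𝓡 1).prod (𝓡 1))).prod 𝓘(ℝ, ℝ)) ⊤ (ε := fun _ => ε) continuous_const fun _ => hε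
  refine ⟨g, hg, ?_⟩
  rw [← contMDiff_iff_contDiff]
  refine g.contMDiff.comp ?_
  have h : ∀ i : Fin 4, ContMDiff 𝓘(ℝ, (Fin 4 → ℝ) × ℝ) (𝓡 1) ∞
      fun q : (Fin 4 → ℝ) × ℝ => Circle.exp (q.1 i) := fun i =>
    contMDiff_circleExp.comp
      (by fun_prop : ContDiff ℝ ∞ fun q : (Fin 4 → ℝ) × ℝ => q.1 i).contMDiff
  exact ((h 1).prodMk ((h 2).prodMk (h 3))).prodMk
    (contDiff_snd : ContDiff ℝ ∞ fun q : (Fin 4 → ℝ) × ℝ => q.2).contMDiff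

theorem torusExp_add_single (θ : Fin 4 → ℝ) (k : Fin 4) :
    torusExp (θ + Pi.single k (2 * Real.pi)) = torusExp θ := by
  unfold torusExp
  fin_cases k <;> simp [Circle.exp_add]

/-- A null-homotopy, made smooth and kept away from the cube, would equate the negative flux of the
standard map with the zero flux of a constant. -/
theorem not_nullhomotopic_stdMap (c : Punctured) :
    ¬ stdMap.Homotopic (ContinuousMap.const _ c) := by
  rintro ⟨H⟩
  obtain ⟨δ, hδ, hHδ⟩ : ∃ δ > 0, ∀ q, δ ≤ ‖(H q : ℂ × ℂ)‖ := by
    have hc : Continuous fun q => ‖(H q : ℂ × ℂ)‖ :=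
      (continuous_subtype_val.comp H.continuous).norm
    obtain ⟨q₀, -, hq₀⟩ := isCompact_univ.exists_isMinOn univ_nonempty hc.continuousOn
    exact ⟨_, norm_pos_iff.2 (H q₀).2, fun q => hq₀ (mem_univ q)⟩
  -- The smoothed homotopy `F` below stays within 2ε of the given one, so its norm is at least 8ε -
  -- 2ε, whereas points of the cube have norm at most 2ε.
  set ε : ℝ := min (δ / 8) (1 / 100) with hεdef
  have hε : 0 < ε := lt_min (by positivity) (by norm_num)
  have hε' : ε ≤ 1 / 100 := min_le_right _ _
  have hεδ : 8 * ε ≤ δ := by linarith [min_le_left (δ / 8) (1 / 100)]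
  let f : (Circle × Circle × Circle) × ℝ → ℂ × ℂ := fun q =>
    (H (projIcc 0 1 zero_le_one q.2, q.1) : ℂ × ℂ)
  have hf : Continuous f := continuous_subtype_val.comp
    (H.continuous.comp ((continuous_projIcc.comp continuous_snd).prodMk continuous_fst))
  obtain ⟨g, hg, hgs⟩ := exists_smooth_approx hf hε
  -- The approximation is corrected by an interpolation linear in time, so that it has exactly the
  -- prescribed values at times 0 and 1.
  let F : (Fin 4 → ℝ) → ℂ × ℂ := fun θ => g (torusExp θ, θ 0)
    + (1 - θ 0) • (stdFun (torusExp θ) - g (torusExp θ, 0))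
    + (θ 0) • ((c : ℂ × ℂ) - g (torusExp θ, 1))
  have hF : ContDiff ℝ ∞ F := by
    have h1 := contDiff_stdFun
    have h2 : ∀ s : (Fin 4 → ℝ) → ℝ, ContDiff ℝ ∞ s →
        ContDiff ℝ ∞ fun θ => g (torusExp θ, s θ) := fun s hs =>
      hgs.comp (contDiff_id.prodMk hs)
    have h3 := h2 (fun θ => θ 0) (by fun_prop)
    have h4 := h2 (fun θ => 0) (by fun_prop)
    have h5 := h2 (fun θ => 1) (by fun_prop)
    have hθ : ContDiff ℝ ∞ fun θ : Fin 4 → ℝ => θ 0 := by fun_prop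
    exact (h3.add ((contDiff_const.sub hθ).smul (h1.sub h4))).add (hθ.smul (contDiff_const.sub h5))
  have hF0 : ∀ θ, θ 0 = 0 → F θ = stdFun (torusExp θ) := fun θ h => by simp [F, h]
  have hF1 : ∀ θ, θ 0 = 1 → F θ = c := fun θ h => by simp [F, h]
  have hFper : ∀ (k : Fin 3) θ, F (θ + Pi.single k.succ (2 * Real.pi)) = F θ := by
    intro k θ
    have : (θ + Pi.single k.succ (2 * Real.pi) : Fin 4 → ℝ) 0 = θ 0 := by simp
    have he : torusExp (θ + Pi.single k.succ (2 * Real.pi)) = torusExp θ :=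
      torusExp_add_single θ k.succ
    simp only [F, he, this]
  have hFnorm : ∀ θ, θ 0 ∈ Icc (0 : ℝ) 1 → 2 * ε < ‖F θ‖ := by
    intro θ hθ
    have a0 : dist (g (torusExp θ, θ 0)) (f (torusExp θ, θ 0)) < ε := hg _
    have a1 : dist (g (torusExp θ, 0)) (f (torusExp θ, 0)) < ε := hg _
    have a2 : dist (g (torusExp θ, 1)) (f (torusExp θ, 1)) < ε := hg _
    have f0 : f (torusExp θ, 0) = stdFun (torusExp θ) := by
      simp only [f, projIcc_left]
      rw [show (⟨0, _⟩ : Icc (0 : ℝ) 1) = (0 : unitInterval) from rfl, H.apply_zero]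
      rfl
    have f1 : f (torusExp θ, 1) = c := by
      simp only [f, projIcc_right]
      rw [show (⟨1, _⟩ : Icc (0 : ℝ) 1) = (1 : unitInterval) from rfl, H.apply_one]
      rfl
    rw [f0, dist_comm, dist_eq_norm] at a1
    rw [f1, dist_comm, dist_eq_norm] at a2
    rw [dist_comm, dist_eq_norm] at a0
    have hfδ : δ ≤ ‖f (torusExp θ, θ 0)‖ := hHδ _
    have e : f (torusExp θ, θ 0) = F θ + ((f (torusExp θ, θ 0) - g (torusExp θ, θ 0))
        - (1 - θ 0) • (stdFun (torusExp θ) - g (torusExp θ, 0))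
        - (θ 0) • ((c : ℂ × ℂ) - g (torusExp θ, 1))) := by
      simp only [F]; abel
    have n1 : ‖(1 - θ 0) • (stdFun (torusExp θ) - g (torusExp θ, 0))‖ ≤ (1 - θ 0) * ε := by
      rw [norm_smul, Real.norm_of_nonneg (by linarith [hθ.2])]
      exact mul_le_mul_of_nonneg_left a1.le (by linarith [hθ.2])
    have n2 : ‖(θ 0) • ((c : ℂ × ℂ) - g (torusExp θ, 1))‖ ≤ θ 0 * ε := by
      rw [norm_smul, Real.norm_of_nonneg hθ.1]
      exact mul_le_mul_of_nonneg_left a2.le hθ.1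
    rw [e] at hfδ
    have t1 := norm_add_le (F θ) ((f (torusExp θ, θ 0) - g (torusExp θ, θ 0))
        - (1 - θ 0) • (stdFun (torusExp θ) - g (torusExp θ, 0))
        - (θ 0) • ((c : ℂ × ℂ) - g (torusExp θ, 1)))
    have t2 := norm_sub_le ((f (torusExp θ, θ 0) - g (torusExp θ, θ 0))
        - (1 - θ 0) • (stdFun (torusExp θ) - g (torusExp θ, 0)))
        ((θ 0) • ((c : ℂ × ℂ) - g (torusExp θ, 1)))
    have t3 := norm_sub_le (f (torusExp θ, θ 0) - g (torusExp θ, θ 0))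
        ((1 - θ 0) • (stdFun (torusExp θ) - g (torusExp θ, 0)))
    linarith
  have hp := contDiff_testComp (ε := ε) hF
  have hflux := flux_eq hp (fun i k θ => by simp only [testComp, hFper]) fun θ hθ => by
    have : ∃ i, ε < |coord i (F θ)| := by
      by_contra! h
      exact absurd (norm_le_of_coord h) (not_le.2 (hFnorm θ hθ))
    obtain ⟨i, hi⟩ := this
    refine ⟨i, ?_⟩
    have hd := ((contDiff_testFun ε i).differentiable (by simp) (coord i (F θ))).hasDerivAt
    rw [deriv_testFun hε i hi] at hd
    have hFi : HasFDerivAt (fun θ => coord i (F θ)) _ θ :=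
      (((contDiff_coord i).comp hF).differentiable (by simp) θ).hasFDerivAt
    have := hd.comp_hasFDerivAt θ hFi
    rw [zero_smul] at this
    exact this.fderiv
  rw [flux_eq_zero_of_const hp (c := fun i => testFun ε i (coord i c))
      (fun i θ h => by rw [testComp, hF1 θ h]),
    flux_congr hp (contDiff_testComp contDiff_stdFun)
      (fun i θ h => by rw [testComp, hF0 θ h, testComp])] at hflux
  exact (flux_std_neg hε hε' 0).ne' hflux

end BorromeanRings

/-! ### The obstruction to link homotopy -/

namespace BorromeanRings

/-- Two neighbours among the three vectors have different directions, so the corresponding wedge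
vanishes nowhere. A straight-line homotopy to the unit vector of the other coordinate then avoids
the origin. -/
theorem IsSpinorMap.exists_homotopic_const {K : Type*} [TopologicalSpace K] {v : Fin 3 → E3}
    (hv : Admissible v) {F : C(K, Punctured)} (hF : IsSpinorMap (fun _ => v) F) :
    ∃ c, F.Homotopic (ContinuousMap.const K c) := by
  obtain ⟨ψ, hψc, hψ, hFψ⟩ := hF
  have key : ∀ c : Punctured, (∀ k, ∀ t : unitInterval,
      (1 - (t : ℝ)) • (F k : ℂ × ℂ) + (t : ℝ) • (c : ℂ × ℂ) ≠ 0) →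
      F.Homotopic (ContinuousMap.const K c) := fun c hc =>
    ⟨⟨⟨fun q => ⟨(1 - (q.1 : ℝ)) • (F q.2 : ℂ × ℂ) + (q.1 : ℝ) • (c : ℂ × ℂ), hc q.2 q.1⟩, by
        refine Continuous.subtype_mk ?_ _
        have : Continuous fun q : unitInterval × K => (F q.2 : ℂ × ℂ) :=
          continuous_subtype_val.comp (F.continuous.comp continuous_snd)
        fun_prop⟩,
      fun k => Subtype.ext (by simp), fun k => Subtype.ext (by simp)⟩⟩
  rcases not_and_or.1 hv.2 with h | h
  · refine ⟨⟨(0, 1), by simp⟩, key _ fun k t h0 => ?_⟩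
    have hw : (F k : ℂ × ℂ).1 ≠ 0 := by
      rw [hFψ]
      exact fun hw => h (sameRay_of_wedge_eq_zero (hψ k 0) (hψ k 1) hw)
    have h1 := congrArg Prod.fst h0
    have h2 := congrArg Prod.snd h0
    simp [hw] at h1
    have h1' : (1 : ℝ) - t = 0 := by exact_mod_cast h1
    simp [h1'] at h2
    rw [h2] at h1'
    simp at h1'
  · refine ⟨⟨(1, 0), by simp⟩, key _ fun k t h0 => ?_⟩
    have hw : (F k : ℂ × ℂ).2 ≠ 0 := by
      rw [hFψ]
      exact fun hw => h (sameRay_of_wedge_eq_zero (hψ k 1) (hψ k 2) hw)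
    have h1 := congrArg Prod.snd h0
    have h2 := congrArg Prod.fst h0
    simp [hw] at h1
    have h1' : (1 : ℝ) - t = 0 := by exact_mod_cast h1
    simp [h1'] at h2
    rw [h2] at h1'
    simp at h1'

/-- The differences of the components of a link. -/
noncomputable def linkVec (f : Fin 3 → Circle → E3) (k : Circle × Circle × Circle) : Fin 3 → E3 :=
  ![f 0 k.1 - f 1 k.2.1, f 1 k.2.1 - f 2 k.2.2, f 2 k.2.2 - f 0 k.1]

/-- The differences sum to zero, which positive multiples of one nonzero vector cannot do. -/
theorem admissible_linkVec {f : Fin 3 → Circle → E3} (hf : DisjointImages f)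
    (k : Circle × Circle × Circle) : Admissible (linkVec f k) := by
  have hne : ∀ i j, i ≠ j → ∀ x y, f i x - f j y ≠ 0 := fun i j hij x y h =>
    (hf hij).ne_of_mem (mem_range_self x) (mem_range_self y) (sub_eq_zero.1 h)
  refine .of_forall (fun i => ?_) fun n a b c ha hb hc h0 h1 h2 => ?_
  · fin_cases i <;> exact hne _ _ (by decide) _ _
  · have hsum : (a + b + c) • n = 0 := by
      rw [add_smul, add_smul, ← h0, ← h1, ← h2]
      simp [linkVec]
    exact (smul_eq_zero.1 hsum).resolve_left (by positivity)

theorem continuous_linkVec {f : Fin 3 → ℝ → Circle → E3}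
    (hf : ∀ i, Continuous fun q : ℝ × Circle => f i q.1 q.2) :
    Continuous fun q : ℝ × (Circle × Circle × Circle) => linkVec (fun i => f i q.1) q.2 := by
  have h0 : Continuous fun q : ℝ × (Circle × Circle × Circle) => f 0 q.1 q.2.1 :=
    (hf 0).comp (by fun_prop : Continuous fun q : ℝ × (Circle × Circle × Circle) => (q.1, q.2.1))
  have h1 : Continuous fun q : ℝ × (Circle × Circle × Circle) => f 1 q.1 q.2.2.1 :=
    (hf 1).comp (by fun_prop : Continuous fun q : ℝ × (Circle × Circle × Circle) => (q.1, q.2.2.1))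
  have h2 : Continuous fun q : ℝ × (Circle × Circle × Circle) => f 2 q.1 q.2.2.2 :=
    (hf 2).comp (by fun_prop : Continuous fun q : ℝ × (Circle × Circle × Circle) => (q.1, q.2.2.2))
  refine continuous_pi fun i => ?_
  fin_cases i
  · exact h0.sub h1
  · exact h1.sub h2
  · exact h2.sub h0

theorem IsSpinorMap.exists_homotopic_link {f : Fin 3 → ℝ → Circle → E3}
    (hf : ∀ i, Continuous fun q : ℝ × Circle => f i q.1 q.2)
    (hd : ∀ τ, DisjointImages fun i => f i τ) {F : C(Circle × Circle × Circle, Punctured)}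
    (hF : IsSpinorMap (linkVec fun i => f i 0) F) :
    ∃ F', IsSpinorMap (linkVec fun i => f i 1) F' ∧ F.Homotopic F' :=
  IsSpinorMap.exists_homotopic (V := fun τ => linkVec fun i => f i τ) (continuous_linkVec hf)
    (fun τ => admissible_linkVec (hd τ)) 0 1 hF

theorem stdVec_one : stdVec 1 = linkVec borromean := by
  funext k i
  fin_cases i <;> ext j <;> fin_cases j <;>
    simp [stdVec, linkVec, borromean, f₁, f₂, f₃, one_add_one_eq_two, sub_eq_add_neg, add_comm]

theorem continuous_stdVec :
    Continuous fun q : ℝ × (Circle × Circle × Circle) => stdVec |q.1| q.2 := by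
  refine continuous_pi fun i => ?_
  have hre : Continuous fun z : Circle => (z : ℂ).re :=
    Complex.continuous_re.comp continuous_induced_dom
  have him : Continuous fun z : Circle => (z : ℂ).im :=
    Complex.continuous_im.comp continuous_induced_dom
  fin_cases i <;> refine (PiLp.continuous_toLp 2 _).comp (continuous_pi fun j => ?_) <;>
    fin_cases j <;> simp <;> fun_prop

theorem not_linkHomotopic_of_isUnlink {V : Fin 3 → Circle → E3} (hV : IsUnlink V) :
    ¬ LinkHomotopic borromean V := by
  rintro ⟨h, hc, hd, h0, h1⟩
  obtain ⟨D, hDs, -, -, hDb, hDd⟩ := hV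
  -- The absolute value makes the deformation admissible at all real times, as `stdVec r` is known
  -- to be only for r ≥ 0.
  obtain ⟨F₁, hF₁, hom₁⟩ := IsSpinorMap.exists_homotopic (V := fun τ => stdVec |τ|)
    continuous_stdVec (fun τ => admissible_stdVec (abs_nonneg τ)) 0 1
    (F := stdMap) (by simpa using isSpinorMap_stdMap)
  rw [abs_one, stdVec_one] at hF₁
  obtain ⟨F₂, hF₂, hom₂⟩ := IsSpinorMap.exists_homotopic_link
    (f := fun i τ => h i (projIcc 0 1 zero_le_one τ)) (F := F₁)
    (fun i => (hc i).comp (by fun_prop :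
      Continuous fun q : ℝ × Circle => (projIcc (0 : ℝ) 1 zero_le_one q.1, q.2)))
    (fun τ => hd _) (by
      simp only [projIcc_left]
      rw [show (fun i => h i ⟨0, _⟩) = borromean from funext fun i => h0 i]
      exact hF₁)
  simp only [projIcc_right] at hF₂
  rw [show (fun i => h i ⟨1, _⟩) = V from funext fun i => h1 i] at hF₂
  have hball : ∀ (τ : ℝ) (z : Circle),
      ((1 - (projIcc (0 : ℝ) 1 zero_le_one τ : ℝ) : ℝ) : ℂ) * z ∈ Metric.closedBall (0 : ℂ) 1 := by
    intro τ z
    have := (projIcc (0 : ℝ) 1 zero_le_one τ).2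
    rw [mem_closedBall_zero_iff, norm_mul, Circle.norm_coe, mul_one, Complex.norm_real,
      Real.norm_of_nonneg (by linarith [this.2])]
    linarith [this.1]
  -- Each component shrinks inside its own disk to the centre `D i 0`; disjointness of the disks
  -- keeps this a link homotopy.
  obtain ⟨F₃, hF₃, hom₃⟩ := IsSpinorMap.exists_homotopic_link
    (f := fun i τ z => D i (((1 - (projIcc (0 : ℝ) 1 zero_le_one τ : ℝ) : ℝ) : ℂ) * z)) (F := F₂)
    (fun i => (hDs i).continuous.comp (by fun_prop)) (fun τ i j hij => by
      refine (hDd hij).mono ?_ ?_ <;> rintro _ ⟨z, rfl⟩ <;> exact mem_image_of_mem _ (hball τ z))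
    (by
      simp only [projIcc_left, sub_zero, Complex.ofReal_one, one_mul, hDb]
      exact hF₂)
  simp only [projIcc_right, sub_self, Complex.ofReal_zero, zero_mul] at hF₃
  have hdc : DisjointImages fun i _ => D i 0 := fun i j hij => by
    refine (hDd hij).mono ?_ ?_ <;> rintro _ ⟨z, rfl⟩ <;>
      exact mem_image_of_mem _ (Metric.mem_closedBall_self zero_le_one)
  obtain ⟨c, hom₄⟩ := IsSpinorMap.exists_homotopic_const
    (admissible_linkVec hdc (1, 1, 1)) (F := F₃) hF₃
  exact not_nullhomotopic_stdMap c (((hom₁.trans hom₂).trans hom₃).trans hom₄)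

end BorromeanRings

namespace BorromeanRings

open Filter Topology

/-! ### Transversality -/

theorem mem_diag {w : E3 × E3} : w ∈ diag ↔ w.1 = w.2 := Iff.rfl

theorem mem_stratumDirections {V : Type*} [NormedAddCommGroup V] [NormedSpace ℝ V]
    {K : Set V} {p v : V} (h : ∀ᶠ r : ℝ in 𝓝 0, p + r • v ∈ K) : v ∈ stratumDirections K p := by
  obtain ⟨ε, hε, h⟩ := Metric.eventually_nhds_iff.1 h
  exact Submodule.subset_span ⟨ε, hε, fun r hr => h (by simpa using hr)⟩

theorem eventually_line_mem_Icc {a b t : ℝ} (ht : t ∈ Ioo a b) (c : ℝ) :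
    ∀ᶠ r : ℝ in 𝓝 0, t + r * c ∈ Icc a b := by
  have hc : ContinuousAt (fun r : ℝ => t + r * c) 0 := by fun_prop
  have : Icc a b ∈ 𝓝 (t + 0 * c) := by simpa using Icc_mem_nhds ht.1 ht.2
  exact hc this

/-- The derivative of a map to `ℝ³ × ℝ³` in the direction `v`, modulo the diagonal, is `d`. -/
def HasDiffDeriv {V : Type*} [NormedAddCommGroup V] [NormedSpace ℝ V] (Φ : V → E3 × E3) (p v : V)
    (d : E3) : Prop :=
  ∀ i, HasDerivAt (fun r : ℝ => (Φ (p + r • v)).1 i - (Φ (p + r • v)).2 i) (d i) 0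

theorem HasDiffDeriv.fderiv_eq {V : Type*} [NormedAddCommGroup V] [NormedSpace ℝ V]
    {Φ : V → E3 × E3} {p v : V} {d : E3} (hΦ : DifferentiableAt ℝ Φ p) (h : HasDiffDeriv Φ p v d) :
    (fderiv ℝ Φ p v).1 - (fderiv ℝ Φ p v).2 = d := by
  have hl : HasDerivAt (fun r : ℝ => Φ (p + r • v)) (fderiv ℝ Φ p v) 0 :=
    hΦ.hasFDerivAt.hasLineDerivAt v
  ext i
  let L : E3 × E3 →L[ℝ] ℝ := (EuclideanSpace.proj i : E3 →L[ℝ] ℝ).comp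
    (ContinuousLinearMap.fst ℝ E3 E3 - ContinuousLinearMap.snd ℝ E3 E3)
  have h1 : HasDerivAt (fun r : ℝ => (Φ (p + r • v)).1 i - (Φ (p + r • v)).2 i)
      (L (fderiv ℝ Φ p v)) 0 := L.hasFDerivAt.comp_hasDerivAt (0 : ℝ) hl
  exact h1.unique (h i)

/-- Subtraction identifies the quotient by the diagonal with ℝ³, so it suffices that the derivative
of the difference is onto. -/
theorem sup_diag_eq_top {V : Type*} [NormedAddCommGroup V] [NormedSpace ℝ V]
    {Φ : V → E3 × E3} {p : V} (hΦ : DifferentiableAt ℝ Φ p) {S : Submodule ℝ V}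
    (h : ∀ d : E3, ∃ v ∈ S, HasDiffDeriv Φ p v d) :
    Submodule.map (fderiv ℝ Φ p : V →ₗ[ℝ] E3 × E3) S ⊔ diag = ⊤ := by
  rw [eq_top_iff]
  rintro w -
  obtain ⟨v, hv, hd⟩ := h (w.1 - w.2)
  rw [Submodule.mem_sup]
  refine ⟨_, Submodule.mem_map_of_mem hv, w - fderiv ℝ Φ p v, ?_, by simp⟩
  have := hd.fderiv_eq hΦ
  rw [mem_diag, Prod.fst_sub, Prod.snd_sub, sub_eq_sub_iff_sub_eq_sub]
  exact this.symm

theorem sup_diag_prod_diag_eq_top {V : Type*} [NormedAddCommGroup V] [NormedSpace ℝ V]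
    {Φ : V → (E3 × E3) × (E3 × E3)} {p : V} (hΦ : DifferentiableAt ℝ Φ p) {S : Submodule ℝ V}
    (h : ∀ d e : E3, ∃ v ∈ S, HasDiffDeriv (fun p => (Φ p).1) p v d ∧
      HasDiffDeriv (fun p => (Φ p).2) p v e) :
    Submodule.map (fderiv ℝ Φ p : V →ₗ[ℝ] (E3 × E3) × (E3 × E3)) S ⊔ diag.prod diag = ⊤ := by
  rw [eq_top_iff]
  rintro w -
  obtain ⟨v, hv, hd, he⟩ := h (w.1.1 - w.1.2) (w.2.1 - w.2.2)
  rw [Submodule.mem_sup]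
  refine ⟨_, Submodule.mem_map_of_mem hv, w - fderiv ℝ Φ p v, ?_, by simp⟩
  have h1 := hd.fderiv_eq hΦ.fst
  have h2 := he.fderiv_eq hΦ.snd
  rw [hΦ.hasFDerivAt.fst.fderiv] at h1
  rw [hΦ.hasFDerivAt.snd.fderiv] at h2
  rw [Submodule.mem_prod, mem_diag, mem_diag]
  constructor
  · rw [Prod.fst_sub, Prod.fst_sub, Prod.snd_sub, sub_eq_sub_iff_sub_eq_sub]
    exact h1.symm
  · rw [Prod.snd_sub, Prod.fst_sub, Prod.snd_sub, sub_eq_sub_iff_sub_eq_sub]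
    exact h2.symm

theorem hasDerivAt_line (a b : ℝ) : HasDerivAt (fun r : ℝ => a + r * b) b 0 := by
  simpa using ((hasDerivAt_id (0 : ℝ)).mul_const b).const_add a

theorem hasDerivAt_cos_line (a b : ℝ) :
    HasDerivAt (fun r : ℝ => Real.cos (a + r * b)) (-Real.sin a * b) 0 := by
  simpa using (hasDerivAt_line a b).cos

theorem hasDerivAt_sin_line (a b : ℝ) :
    HasDerivAt (fun r : ℝ => Real.sin (a + r * b)) (Real.cos a * b) 0 := by
  simpa using (hasDerivAt_line a b).sin

theorem contDiff_E3 {V : Type*} [NormedAddCommGroup V] [NormedSpace ℝ V] {a b c : V → ℝ}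
    (ha : ContDiff ℝ ∞ a) (hb : ContDiff ℝ ∞ b) (hc : ContDiff ℝ ∞ c) :
    ContDiff ℝ ∞ fun p => (!₂[a p, b p, c p] : E3) := by
  rw [contDiff_euclidean]
  intro i
  fin_cases i
  · exact ha
  · exact hb
  · exact hc

theorem exp_re (θ : ℝ) : (Circle.exp θ : ℂ).re = Real.cos θ := by
  rw [Circle.coe_exp, Complex.exp_ofReal_mul_I_re]

theorem exp_im (θ : ℝ) : (Circle.exp θ : ℂ).im = Real.sin θ := by
  rw [Circle.coe_exp, Complex.exp_ofReal_mul_I_im]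

theorem circle_ext {z w : Circle} (h1 : (z : ℂ).re = (w : ℂ).re) (h2 : (z : ℂ).im = (w : ℂ).im) :
    z = w := Circle.ext (Complex.ext h1 h2)

/-! ### The map `G` -/

/-- `H₃` and `H₁` differ only in the last coordinate, by 4 - (t - 2)² = 4t - t². -/
theorem G_eq (y z : Circle) (t s : ℝ) : G y z t s =
    (!₂[2 * (z : ℂ).re, (z : ℂ).im, 0], !₂[(y : ℂ).re, t, 2 * (y : ℂ).im + s * (4 * t - t ^ 2)]) := by
  refine Prod.ext rfl (E3_ext ?_ ?_ ?_) <;> simp [G, H₁, H₃] <;> ring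

theorem contDiff_G {V : Type*} [NormedAddCommGroup V] [NormedSpace ℝ V] {a b c d : V → ℝ}
    (ha : ContDiff ℝ ∞ a) (hb : ContDiff ℝ ∞ b) (hc : ContDiff ℝ ∞ c) (hd : ContDiff ℝ ∞ d) :
    ContDiff ℝ ∞ fun p => G (Circle.exp (a p)) (Circle.exp (b p)) (c p) (d p) := by
  simp only [G_eq, exp_re, exp_im]
  exact (contDiff_E3 (by fun_prop) (by fun_prop) (by fun_prop)).prodMk
    (contDiff_E3 (by fun_prop) (by fun_prop) (by fun_prop))

theorem G_mem_diag {y z : Circle} {t s : ℝ} : G y z t s ∈ diag ↔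
    2 * (z : ℂ).re = (y : ℂ).re ∧ (z : ℂ).im = t ∧ 2 * (y : ℂ).im + s * (4 * t - t ^ 2) = 0 := by
  rw [G_eq, mem_diag]
  constructor
  · intro h
    have e0 := congrArg (fun v : E3 => v 0) h
    have e1 := congrArg (fun v : E3 => v 1) h
    have e2 := congrArg (fun v : E3 => v 2) h
    simp at e0 e1 e2
    exact ⟨e0, e1, e2.symm⟩
  · rintro ⟨e0, e1, e2⟩
    exact E3_ext (by simpa using e0) (by simpa using e1) (by simpa using e2.symm)

/-- Bounds for the parameters of the points in the preimage of the diagonal. -/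
theorem bounds_of_G_mem_diag {y z : Circle} {t s : ℝ} (ht : t ∈ Icc (0 : ℝ) 4)
    (hs : s ∈ Icc (0 : ℝ) 1) (h : G y z t s ∈ diag) :
    0 < t ∧ t ≤ 1 ∧ 0 < 4 * t - t ^ 2 ∧ s < 1 ∧ (y : ℂ).im ≤ 0 := by
  obtain ⟨h0, h1, h2⟩ := G_mem_diag.1 h
  have hy := circle_re_sq_add_im_sq y
  have hz := circle_re_sq_add_im_sq z
  rw [h1] at hz
  rw [← h0] at hy
  have ht1 : t ≤ 1 := by nlinarith [sq_nonneg (z : ℂ).re]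
  -- From 2 cos z = cos y follows cos² z ≤ 1/4, hence t² = sin² z ≥ 3/4.
  have ht2 : 3 / 4 ≤ t ^ 2 := by nlinarith [sq_nonneg (y : ℂ).im]
  have ht0 : 0 < t := lt_of_le_of_ne ht.1 (by rintro rfl; norm_num at ht2)
  have h3 : 3 * t ≤ 4 * t - t ^ 2 := by nlinarith
  refine ⟨ht0, ht1, by linarith, ?_, by nlinarith [mul_nonneg hs.1 (by linarith : 0 ≤ 4 * t - t ^ 2)]⟩
  -- At s = 1 the last equation gives 2|sin y| = 4t - t² ≥ 3t > 2.
  by_contra! hs1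
  have hs' : s = 1 := le_antisymm hs.2 hs1
  subst hs'
  have h4 : (2 * (y : ℂ).im) ^ 2 = (4 * t - t ^ 2) ^ 2 := by
    rw [← neg_sq]; congr 1; linarith
  nlinarith

theorem transverseOn_G :
    TransverseOn {p : ℝ × ℝ × ℝ × ℝ | p.2.2.1 ∈ Set.Icc 0 4 ∧ p.2.2.2 ∈ Set.Icc 0 1}
      (fun p => G (Circle.exp p.1) (Circle.exp p.2.1) p.2.2.1 p.2.2.2) diag := by
  rintro ⟨y, z, t, s⟩ ⟨ht, hs⟩ h
  dsimp only at ht hs h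
  obtain ⟨ht0, ht1, hw, hs1, -⟩ := bounds_of_G_mem_diag ht hs h
  obtain ⟨-, h1, h2⟩ := G_mem_diag.1 h
  rw [exp_im] at h1 h2
  have hd : ContDiff ℝ ∞ fun p : ℝ × ℝ × ℝ × ℝ =>
      G (Circle.exp p.1) (Circle.exp p.2.1) p.2.2.1 p.2.2.2 :=
    contDiff_G (by fun_prop) (by fun_prop) (by fun_prop) (by fun_prop)
  refine sup_diag_eq_top (hd.differentiable (by simp) _) fun d => ?_
  have key : ∀ v1 v2 v3 v4 : ℝ, (v4 = 0 ∨ 0 < s) →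
      d 0 = -2 * Real.sin z * v2 + Real.sin y * v1 → d 1 = Real.cos z * v2 - v3 →
      d 2 = -2 * Real.cos y * v1 - s * (4 - 2 * t) * v3 - (4 * t - t ^ 2) * v4 →
      ∃ v ∈ stratumDirections
        {p : ℝ × ℝ × ℝ × ℝ | p.2.2.1 ∈ Set.Icc 0 4 ∧ p.2.2.2 ∈ Set.Icc 0 1} (y, z, t, s),
        HasDiffDeriv (fun p : ℝ × ℝ × ℝ × ℝ =>
          G (Circle.exp p.1) (Circle.exp p.2.1) p.2.2.1 p.2.2.2) (y, z, t, s) v d := by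
    intro v1 v2 v3 v4 hv4 e0 e1 e2
    refine ⟨(v1, v2, v3, v4), mem_stratumDirections ?_, fun i => ?_⟩
    · have hs' : ∀ᶠ r : ℝ in 𝓝 0, s + r * v4 ∈ Icc (0 : ℝ) 1 := by
        rcases hv4 with rfl | h
        · simpa using hs
        · exact eventually_line_mem_Icc ⟨h, hs1⟩ v4
      exact (eventually_line_mem_Icc ⟨ht0, by linarith⟩ v3).and hs'
    · have lt := hasDerivAt_line t v3
      have ls := hasDerivAt_line s v4
      simp only [G_eq, exp_re, exp_im]
      fin_cases i
      · change HasDerivAt (fun r : ℝ => 2 * Real.cos (z + r * v2) - Real.cos (y + r * v1)) (d 0) 0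
        refine HasDerivAt.congr_deriv
          (((hasDerivAt_cos_line z v2).const_mul 2).fun_sub (hasDerivAt_cos_line y v1)) ?_
        rw [e0]; ring
      · change HasDerivAt (fun r : ℝ => Real.sin (z + r * v2) - (t + r * v3)) (d 1) 0
        exact HasDerivAt.congr_deriv ((hasDerivAt_sin_line z v2).fun_sub lt) e1.symm
      · change HasDerivAt (fun r : ℝ => 0 - (2 * Real.sin (y + r * v1)
          + (s + r * v4) * (4 * (t + r * v3) - (t + r * v3) ^ 2))) (d 2) 0
        refine HasDerivAt.congr_deriv ((((hasDerivAt_sin_line y v1).const_mul 2).fun_add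
          (ls.fun_mul ((lt.const_mul 4).fun_sub (lt.fun_pow 2)))).const_sub 0) ?_
        rw [e2]; simp; ring
  have ht' : Real.sin z ≠ 0 := by rw [h1]; exact ht0.ne'
  -- The only boundary face met is s = 0. There s cannot vary, but sin y = 0, so moving y adjusts
  -- the last coordinate. Elsewhere s does this.
  rcases hs.1.eq_or_lt with h0 | h0
  · subst h0
    have hsy : Real.sin y = 0 := by linarith
    have hcy : Real.cos y ≠ 0 := by
      intro hc
      have := Real.sin_sq_add_cos_sq y
      rw [hsy, hc] at this
      norm_num at this
    refine key (-(d 2) / (2 * Real.cos y)) (-(d 0) / (2 * Real.sin z))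
      (Real.cos z * (-(d 0) / (2 * Real.sin z)) - d 1) 0 (Or.inl rfl) ?_ (by ring) ?_
    · rw [hsy]; field_simp; ring
    · field_simp; ring
  · set v2 := -(d 0) / (2 * Real.sin z) with hv2
    set v3 := Real.cos z * v2 - d 1 with hv3
    refine key 0 v2 v3 (-(d 2 + s * (4 - 2 * t) * v3) / (4 * t - t ^ 2)) (Or.inr h0) ?_ (by ring) ?_
    · rw [hv2]; field_simp; ring
    · rw [mul_div_cancel₀ _ hw.ne']; ring

/-- The parametrization of the preimage of the diagonal under `G`. -/
noncomputable def arc (r : ℝ) : ℝ × ℝ × ℝ × ℝ :=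
  -- For r in [0, 1] the angle runs through [π, 2π], the half circle where sin y ≤ 0 and hence s ≥
  -- 0.
  let y := Real.pi * r + Real.pi
  let z := Real.arccos (Real.cos y / 2)
  (y, z, Real.sin z, -2 * Real.sin y / (4 * Real.sin z - Real.sin z ^ 2))

theorem cos_arccos_half (θ : ℝ) : Real.cos (Real.arccos (Real.cos θ / 2)) = Real.cos θ / 2 :=
  Real.cos_arccos (by linarith [Real.neg_one_le_cos θ]) (by linarith [Real.cos_le_one θ])

theorem sin_arccos_half_sq (θ : ℝ) :
    Real.sin (Real.arccos (Real.cos θ / 2)) ^ 2 = 1 - Real.cos θ ^ 2 / 4 := by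
  have := Real.sin_sq_add_cos_sq (Real.arccos (Real.cos θ / 2))
  rw [cos_arccos_half] at this
  linarith

theorem sin_arccos_half_bound (θ : ℝ) :
    3 / 4 ≤ Real.sin (Real.arccos (Real.cos θ / 2)) ∧
    Real.sin (Real.arccos (Real.cos θ / 2)) ≤ 1 ∧
    2 ≤ 4 * Real.sin (Real.arccos (Real.cos θ / 2)) -
      Real.sin (Real.arccos (Real.cos θ / 2)) ^ 2 := by
  have h0 := Real.sin_nonneg_of_nonneg_of_le_pi (Real.arccos_nonneg (Real.cos θ / 2))
    (Real.arccos_le_pi _)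
  have h1 := sin_arccos_half_sq θ
  have h2 : Real.cos θ ^ 2 ≤ 1 := Real.cos_sq_le_one θ
  have h3 := Real.sin_le_one (Real.arccos (Real.cos θ / 2))
  set t := Real.sin (Real.arccos (Real.cos θ / 2))
  have h4 : 3 / 4 ≤ t := by nlinarith
  exact ⟨h4, h3, by nlinarith⟩

theorem contDiff_arc : ContDiff ℝ ∞ arc := by
  have hy : ContDiff ℝ ∞ fun r : ℝ => Real.pi * r + Real.pi := by fun_prop
  have hz : ContDiff ℝ ∞ fun r : ℝ => Real.arccos (Real.cos (Real.pi * r + Real.pi) / 2) := by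
    rw [contDiff_iff_contDiffAt]
    intro r
    have h1 := Real.neg_one_le_cos (Real.pi * r + Real.pi)
    have h2 := Real.cos_le_one (Real.pi * r + Real.pi)
    exact (Real.contDiffAt_arccos (by linarith) (by linarith)).comp r
      (by fun_prop : ContDiff ℝ ∞ fun r : ℝ => Real.cos (Real.pi * r + Real.pi) / 2).contDiffAt
  have ht := hz.sin
  refine hy.prodMk (hz.prodMk (ht.prodMk (ContDiff.div (by fun_prop) (by fun_prop) fun r => ?_)))
  linarith [(sin_arccos_half_bound (Real.pi * r + Real.pi)).2.2]

/-- The circle-valued parametrization of the preimage of the diagonal under `G`. -/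
noncomputable def arcPoint (r : ℝ) : Circle × Circle × ℝ × ℝ :=
  (Circle.exp (arc r).1, Circle.exp (arc r).2.1, (arc r).2.2)

theorem image_arcPoint : arcPoint '' Icc 0 1 = preimageG := by
  have hpi := Real.pi_pos
  ext ⟨y, z, t, s⟩
  constructor
  · rintro ⟨r, hr, hq⟩
    simp only [arcPoint, arc, Prod.mk.injEq] at hq
    obtain ⟨rfl, rfl, rfl, rfl⟩ := hq
    obtain ⟨b1, b2, b3⟩ := sin_arccos_half_bound (Real.pi * r + Real.pi)
    have hsin : Real.sin (Real.pi * r + Real.pi) ≤ 0 := by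
      rw [Real.sin_add_pi, neg_nonpos]
      exact Real.sin_nonneg_of_nonneg_of_le_pi (by have := hr.1; positivity) (by nlinarith [hr.2])
    have hsin' := Real.neg_one_le_sin (Real.pi * r + Real.pi)
    refine ⟨⟨by linarith, by linarith⟩, ⟨?_, ?_⟩, ?_⟩
    · exact div_nonneg (by linarith) (by linarith)
    · exact (div_le_one (by linarith)).2 (by linarith)
    · rw [G_mem_diag, exp_re, exp_im, exp_re, exp_im]
      refine ⟨?_, rfl, ?_⟩
      · rw [cos_arccos_half]; ring
      · rw [div_mul_cancel₀ _ (by linarith)]; ring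
  · rintro ⟨ht, hs, h⟩
    dsimp only at ht hs h
    obtain ⟨ht0, ht1, hw, hs1, hy0⟩ := bounds_of_G_mem_diag ht hs h
    obtain ⟨h0, h1, h2⟩ := G_mem_diag.1 h
    have hy := circle_re_sq_add_im_sq y
    have hz := circle_re_sq_add_im_sq z
    have hb := abs_le_of_sq_le_sq' (a := (y : ℂ).re) (b := 1) (by nlinarith) (by norm_num)
    have hθ : Real.pi * (Real.arccos (-(y : ℂ).re) / Real.pi) + Real.pi
        = Real.arccos (-(y : ℂ).re) + Real.pi := by field_simp
    have hcos : Real.cos (Real.arccos (-(y : ℂ).re) + Real.pi) = (y : ℂ).re := by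
      rw [Real.cos_add_pi, Real.cos_arccos (by linarith) (by linarith), neg_neg]
    have hsin : Real.sin (Real.arccos (-(y : ℂ).re) + Real.pi) = (y : ℂ).im := by
      rw [Real.sin_add_pi, Real.sin_arccos, neg_sq, show 1 - (y : ℂ).re ^ 2 = (y : ℂ).im ^ 2 by linarith,
        Real.sqrt_sq_eq_abs, abs_of_nonpos hy0, neg_neg]
    have hsz : Real.sin (Real.arccos ((y : ℂ).re / 2)) = t := by
      rw [Real.sin_arccos, ← h0, show 1 - (2 * (z : ℂ).re / 2) ^ 2 = t ^ 2 by rw [← h1]; linarith,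
        Real.sqrt_sq ht0.le]
    refine ⟨Real.arccos (-(y : ℂ).re) / Real.pi,
      ⟨div_nonneg (Real.arccos_nonneg _) hpi.le, (div_le_one hpi).2 (Real.arccos_le_pi _)⟩, ?_⟩
    simp only [arcPoint, arc, hθ, hcos, hsin, hsz, Prod.mk.injEq, true_and]
    refine ⟨circle_ext ?_ ?_, circle_ext ?_ ?_, ?_⟩
    · rw [exp_re, hcos]
    · rw [exp_im, hsin]
    · rw [exp_re, Real.cos_arccos (by linarith) (by linarith)]; linarith
    · rw [exp_im, hsz, h1]
    · rw [div_eq_iff hw.ne']; linarith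

theorem isSmoothArc_preimageG : IsSmoothArc preimageG := by
  have hpi := Real.pi_pos
  refine ⟨arc, contDiff_arc, fun r _ h0 => ?_, fun r hr r' hr' h => ?_, image_arcPoint⟩
  · have h1 : HasDerivAt (fun r => (arc r).1) (deriv arc r).1 r :=
      (ContinuousLinearMap.fst ℝ ℝ (ℝ × ℝ × ℝ)).hasFDerivAt.comp_hasDerivAt r
        (contDiff_arc.differentiable (by simp) r).hasDerivAt
    rw [h0] at h1
    have h2 : HasDerivAt (fun r : ℝ => Real.pi * r + Real.pi) Real.pi r := by
      simpa using ((hasDerivAt_id r).const_mul Real.pi).add_const Real.pi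
    exact hpi.ne (h1.unique h2)
  · have h1 := congrArg Prod.fst h
    have h2 := Circle.exp_injOn_Icc (a := Real.pi) (b := 2 * Real.pi) (by linarith)
      (x₁ := Real.pi * r + Real.pi) (x₂ := Real.pi * r' + Real.pi)
      ⟨by nlinarith [hr.1], by nlinarith [hr.2]⟩ ⟨by nlinarith [hr'.1], by nlinarith [hr'.2]⟩ h1
    exact mul_left_cancel₀ hpi.ne' (add_right_cancel h2)

theorem isCompact_preimageG : IsCompact preimageG := by
  rw [← image_arcPoint]
  have h := contDiff_arc.continuous
  refine isCompact_Icc.image ?_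
  unfold arcPoint
  fun_prop

/-- The circle coordinates determine t = sin z, and then s, since its coefficient 4t - t² is
positive. -/
theorem preimageG_ext {q q' : preimageG} (h : q.1.2.1 = q'.1.2.1) (hy : q.1.1 = q'.1.1) :
    q = q' := by
  obtain ⟨⟨y, z, t, s⟩, ht, hs, hq⟩ := q
  obtain ⟨⟨y', z', t', s'⟩, ht', hs', hq'⟩ := q'
  dsimp only at h hy ht hs hq ht' hs' hq'
  subst h hy
  obtain ⟨-, -, hw, -, -⟩ := bounds_of_G_mem_diag ht hs hq
  obtain ⟨-, h1, h2⟩ := G_mem_diag.1 hq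
  obtain ⟨-, h1', h2'⟩ := G_mem_diag.1 hq'
  have ht : t = t' := h1.symm.trans h1'
  subst ht
  have hss : s = s' := mul_right_cancel₀ hw.ne' (by linarith)
  subst hss
  rfl

/-- The preimage is compact, so injectivity suffices: y determines cos z, and sin z = t > 0 fixes
the sign. -/
theorem isEmbedding_fst_preimageG : Topology.IsEmbedding fun q : preimageG => q.1.1 := by
  have := isCompact_iff_compactSpace.1 isCompact_preimageG
  refine (Continuous.isClosedEmbedding (by fun_prop) fun q q' h => preimageG_ext ?_ h).isEmbedding
  obtain ⟨⟨y, z, t, s⟩, ht, hs, hq⟩ := q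
  obtain ⟨⟨y', z', t', s'⟩, ht', hs', hq'⟩ := q'
  dsimp only at h ht hs hq ht' hs' hq' ⊢
  subst h
  obtain ⟨ht0, -⟩ := bounds_of_G_mem_diag ht hs hq
  obtain ⟨ht0', -⟩ := bounds_of_G_mem_diag ht' hs' hq'
  obtain ⟨h0, h1, -⟩ := G_mem_diag.1 hq
  obtain ⟨h0', h1', -⟩ := G_mem_diag.1 hq'
  have hz := circle_re_sq_add_im_sq z
  have hz' := circle_re_sq_add_im_sq z'
  have hre : (z : ℂ).re = (z' : ℂ).re := by linarith
  refine circle_ext hre ?_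
  rw [← sq_eq_sq₀ (by linarith) (by linarith)]
  rw [hre] at hz
  linarith

/-- Here z determines cos y, and the sign is fixed by sin y ≤ 0. -/
theorem isEmbedding_snd_preimageG : Topology.IsEmbedding fun q : preimageG => q.1.2.1 := by
  have := isCompact_iff_compactSpace.1 isCompact_preimageG
  refine (Continuous.isClosedEmbedding (by fun_prop) fun q q' h => preimageG_ext h ?_).isEmbedding
  obtain ⟨⟨y, z, t, s⟩, ht, hs, hq⟩ := q
  obtain ⟨⟨y', z', t', s'⟩, ht', hs', hq'⟩ := q'
  dsimp only at h ht hs hq ht' hs' hq' ⊢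
  subst h
  obtain ⟨-, -, -, -, hy0⟩ := bounds_of_G_mem_diag ht hs hq
  obtain ⟨-, -, -, -, hy0'⟩ := bounds_of_G_mem_diag ht' hs' hq'
  obtain ⟨h0, -⟩ := G_mem_diag.1 hq
  obtain ⟨h0', -⟩ := G_mem_diag.1 hq'
  have hy := circle_re_sq_add_im_sq y
  have hy' := circle_re_sq_add_im_sq y'
  have hre : (y : ℂ).re = (y' : ℂ).re := by linarith
  refine circle_ext hre ?_
  rw [← neg_inj, ← sq_eq_sq₀ (by linarith) (by linarith)]
  rw [hre] at hy
  linarith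

end BorromeanRings

namespace BorromeanRings

open Filter Topology

/-! ### The links -/

theorem disjointImages_of_ne {f : Fin 3 → Circle → E3} (h01 : ∀ x y, f 0 x ≠ f 1 y)
    (h12 : ∀ y z, f 1 y ≠ f 2 z) (h02 : ∀ x z, f 0 x ≠ f 2 z) : DisjointImages f := by
  have d : ∀ i j, (∀ x y, f i x ≠ f j y) → Disjoint (range (f i)) (range (f j)) := fun i j h => by
    rw [Set.disjoint_left]
    rintro _ ⟨x, rfl⟩ ⟨y, hy⟩
    exact h x y hy.symm
  intro i j hij
  fin_cases i <;> fin_cases j <;> first | exact absurd rfl hij | skip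
  · exact d _ _ h01
  · exact d _ _ h02
  · exact (d _ _ h01).symm
  · exact d _ _ h12
  · exact (d _ _ h02).symm
  · exact (d _ _ h12).symm

theorem coords_eq {v w : E3} (h : v = w) : v 0 = w 0 ∧ v 1 = w 1 ∧ v 2 = w 2 := by simp [h]

/-- An intersection would need cos y = 0 and sin x = 2 sin y = ±2. This holds for every `t`: the
second component never crosses the first while it moves away. -/
theorem f₁_ne_H₁ (x y : Circle) (t : ℝ) : f₁ x ≠ H₁ y t := by
  intro h
  obtain ⟨h0, -, h2⟩ := coords_eq h
  simp [f₁, H₁] at h0 h2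
  have hx := circle_re_sq_add_im_sq x
  have hy := circle_re_sq_add_im_sq y
  rw [← h0] at hy
  rw [h2] at hx
  linarith [sq_nonneg (x : ℂ).re]

theorem f₁_ne_f₃ (x z : Circle) : f₁ x ≠ f₃ z := by
  intro h
  obtain ⟨h0, h1, h2⟩ := coords_eq h
  simp [f₁, f₃] at h0 h1 h2
  have hx := circle_re_sq_add_im_sq x
  have hz := circle_re_sq_add_im_sq z
  rw [h2] at hx
  rw [h0, ← h1] at hz
  linarith

theorem f₂_ne_f₃ (y z : Circle) : f₂ y ≠ f₃ z := by
  intro h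
  obtain ⟨h0, h1, h2⟩ := coords_eq h
  simp [f₂, f₃] at h0 h1 h2
  have hy := circle_re_sq_add_im_sq y
  have hz := circle_re_sq_add_im_sq z
  rw [h0, h2] at hy
  rw [← h1] at hz
  linarith

theorem e₂_ne_f₃ (y z : Circle) : e₂ y ≠ f₃ z := by
  intro h
  obtain ⟨-, h1, -⟩ := coords_eq h
  simp [e₂, f₃] at h1
  have hz := circle_re_sq_add_im_sq z
  nlinarith [sq_nonneg (z : ℂ).re]

theorem contDiff_f₁ {V : Type*} [NormedAddCommGroup V] [NormedSpace ℝ V] {a : V → ℝ}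
    (ha : ContDiff ℝ ∞ a) : ContDiff ℝ ∞ fun p => f₁ (Circle.exp (a p)) := by
  simp only [f₁, exp_re, exp_im]
  exact contDiff_E3 (by fun_prop) (by fun_prop) (by fun_prop)

theorem contDiff_f₃ {V : Type*} [NormedAddCommGroup V] [NormedSpace ℝ V] {a : V → ℝ}
    (ha : ContDiff ℝ ∞ a) : ContDiff ℝ ∞ fun p => f₃ (Circle.exp (a p)) := by
  simp only [f₃, exp_re, exp_im]
  exact contDiff_E3 (by fun_prop) (by fun_prop) (by fun_prop)

theorem contDiff_H₁ {V : Type*} [NormedAddCommGroup V] [NormedSpace ℝ V] {a b : V → ℝ}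
    (ha : ContDiff ℝ ∞ a) (hb : ContDiff ℝ ∞ b) :
    ContDiff ℝ ∞ fun p => H₁ (Circle.exp (a p)) (b p) := by
  simp only [H₁, exp_re, exp_im]
  exact contDiff_E3 (by fun_prop) (by fun_prop) (by fun_prop)

theorem isLinkMap_borromean : IsLinkMap borromean := by
  refine ⟨fun i => ?_, disjointImages_of_ne (fun x y => f₁_ne_H₁ x y 0) f₂_ne_f₃ f₁_ne_f₃⟩
  fin_cases i
  · exact contDiff_f₁ contDiff_id
  · exact contDiff_H₁ contDiff_id (contDiff_const (c := (0 : ℝ)))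
  · exact contDiff_f₃ contDiff_id

theorem isLinkMap_unlink : IsLinkMap unlink := by
  refine ⟨fun i => ?_, disjointImages_of_ne (fun x y => f₁_ne_H₁ x y 4) e₂_ne_f₃ f₁_ne_f₃⟩
  fin_cases i
  · exact contDiff_f₁ contDiff_id
  · exact contDiff_H₁ contDiff_id (contDiff_const (c := (4 : ℝ)))
  · exact contDiff_f₃ contDiff_id

/-- Disks bounded by the components of the unlink. -/
noncomputable def unlinkDisk : Fin 3 → ℂ → E3 :=
  -- The flat disks of the first and third component would meet. The first is replaced by a
  -- paraboloid cap that passes around the third disk.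
  ![fun w => !₂[4 * (1 - (w.re ^ 2 + w.im ^ 2)), 2 * w.re, w.im],
    fun w => !₂[w.re, 4, 2 * w.im],
    fun w => !₂[2 * w.re, w.im, 0]]

theorem contDiff_unlinkDisk (i : Fin 3) : ContDiff ℝ ∞ (unlinkDisk i) := by
  have hre : ContDiff ℝ ∞ Complex.re := Complex.reCLM.contDiff
  have him : ContDiff ℝ ∞ Complex.im := Complex.imCLM.contDiff
  fin_cases i <;> exact contDiff_E3 (by fun_prop) (by fun_prop) (by fun_prop)

theorem exists_leftInverse_unlinkDisk (i : Fin 3) :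
    ∃ L : E3 →L[ℝ] ℂ, ∀ w, L (unlinkDisk i w) = w := by
  let P : Fin 3 → E3 →L[ℝ] ℝ := fun j => EuclideanSpace.proj j
  fin_cases i
  · refine ⟨(P 1).smulRight (1 / 2 : ℂ) + (P 2).smulRight Complex.I, fun w => ?_⟩
    apply Complex.ext <;> simp [P, unlinkDisk]
    ring
  · refine ⟨(P 0).smulRight (1 : ℂ) + (P 2).smulRight ((1 / 2 : ℝ) • Complex.I), fun w => ?_⟩
    apply Complex.ext <;> simp [P, unlinkDisk]
    ring
  · refine ⟨(P 0).smulRight (1 / 2 : ℂ) + (P 1).smulRight Complex.I, fun w => ?_⟩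
    apply Complex.ext <;> simp [P, unlinkDisk]
    ring

theorem isUnlink_unlink : IsUnlink unlink := by
  refine ⟨unlinkDisk, contDiff_unlinkDisk, fun i => ?_, fun i w _ => ?_, fun i z => ?_, ?_⟩
  · obtain ⟨L, hL⟩ := exists_leftInverse_unlinkDisk i
    exact (Function.LeftInverse.injective hL).injOn
  · obtain ⟨L, hL⟩ := exists_leftInverse_unlinkDisk i
    have h1 := L.hasFDerivAt.comp w
      ((contDiff_unlinkDisk i).differentiable (by simp) w).hasFDerivAt
    have h2 : (⇑L ∘ unlinkDisk i) = id := funext hL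
    rw [h2] at h1
    have h3 := h1.unique (hasFDerivAt_id w)
    refine Function.LeftInverse.injective (g := L) fun v => ?_
    exact DFunLike.congr_fun h3 v
  · have hz := circle_re_sq_add_im_sq z
    fin_cases i
    · simp [unlinkDisk, unlink, f₁, hz]
    · rfl
    · rfl
  · have hb : ∀ w : ℂ, w ∈ Metric.closedBall (0 : ℂ) 1 → w.re ^ 2 + w.im ^ 2 ≤ 1 := fun w hw => by
      rw [mem_closedBall_zero_iff] at hw
      have := Complex.sq_norm w
      rw [Complex.normSq_apply] at this
      nlinarith [norm_nonneg w]
    have d : ∀ i j, (∀ w w' : ℂ, w.re ^ 2 + w.im ^ 2 ≤ 1 → w'.re ^ 2 + w'.im ^ 2 ≤ 1 →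
        unlinkDisk i w ≠ unlinkDisk j w') →
        Disjoint (unlinkDisk i '' Metric.closedBall 0 1) (unlinkDisk j '' Metric.closedBall 0 1) := by
      intro i j h
      rw [Set.disjoint_left]
      rintro _ ⟨w, hw, rfl⟩ ⟨w', hw', h'⟩
      exact h w w' (hb w hw) (hb w' hw') h'.symm
    have d01 := d 0 1 fun w w' hw hw' h => by
      obtain ⟨-, h1, -⟩ := coords_eq h
      simp [unlinkDisk] at h1
      nlinarith [sq_nonneg w.im]
    have d12 := d 1 2 fun w w' hw hw' h => by
      obtain ⟨-, h1, -⟩ := coords_eq h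
      simp [unlinkDisk] at h1
      nlinarith [sq_nonneg w'.re]
    have d02 := d 0 2 fun w w' hw hw' h => by
      obtain ⟨h0, h1, h2⟩ := coords_eq h
      simp [unlinkDisk] at h0 h1 h2
      rw [h2] at h0
      have h3 : w'.re = 2 * (1 - w.re ^ 2) := by linarith
      rw [h3, ← h1] at hw'
      -- With a = Re w, an intersection would give |w'|² = 4(a⁴ - a² + 1) ≥ 3.
      nlinarith [sq_nonneg (w.re ^ 2 - 1 / 2)]
    intro i j hij
    fin_cases i <;> fin_cases j <;> first | exact absurd rfl hij | skip
    · exact d01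
    · exact d02
    · exact d01.symm
    · exact d12
    · exact d02.symm
    · exact d12.symm

/-! ### The path in the second stage -/

theorem isStagePath_liftedPath : IsStagePath 4 liftedPath := by
  refine ⟨fun i => ?_, fun h => ?_, fun h x y u _ => ?_, fun h x y u hu => ?_⟩
  · fin_cases i
    · exact contDiff_f₁ contDiff_fst
    · exact contDiff_H₁ contDiff_fst contDiff_snd
    · exact contDiff_f₃ contDiff_fst
  · have h1 : ContDiff ℝ ∞ fun p : ℝ × ℝ × ℝ × ℝ => p.1 := by fun_prop
    have h2 : ContDiff ℝ ∞ fun p : ℝ × ℝ × ℝ × ℝ => p.2.1 := by fun_prop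
    have h3 : ContDiff ℝ ∞ fun p : ℝ × ℝ × ℝ × ℝ => p.2.2.1 := by fun_prop
    have h4 : ContDiff ℝ ∞ fun p : ℝ × ℝ × ℝ × ℝ => p.2.2.2 := by fun_prop
    fin_cases h
    · exact (contDiff_f₁ h1).prodMk (contDiff_f₃ h2)
    · exact (contDiff_H₁ h1 h4).prodMk (contDiff_f₁ h2)
    · exact contDiff_G h2 h1 h4 h3
  · fin_cases h
    · rfl
    · rfl
    · change G y x u 0 = (f₃ x, H₁ y u)
      simp [G]
  · fin_cases h
    · exact fun hd => f₁_ne_f₃ x y hd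
    · exact fun hd => f₁_ne_H₁ y x u (Eq.symm hd)
    · exact fun hd => (bounds_of_G_mem_diag hu (right_mem_Icc.2 zero_le_one) hd).2.2.2.1.false

theorem atLinkMap_borromean : AtLinkMap liftedPath 0 borromean := by
  refine ⟨fun i x => ?_, fun h x y s _ => ?_⟩
  · fin_cases i <;> rfl
  · fin_cases h
    · rfl
    · rfl
    · change G y x 0 s = (f₃ x, f₂ y)
      rw [G_eq]
      simp [f₃, f₂]

theorem atLinkMap_unlink : AtLinkMap liftedPath 4 unlink := by
  refine ⟨fun i x => ?_, fun h x y s _ => ?_⟩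
  · fin_cases i <;> rfl
  · fin_cases h
    · rfl
    · rfl
    · change G y x 4 s = (f₃ x, e₂ y)
      rw [G_eq]
      simp [f₃, e₂]
      norm_num

/-! ### The obstruction manifold -/

/-- All pieces of the obstruction manifold are empty, except for one. -/
theorem eq_disk₂_of_mem {k : Piece} {p : Param}
    (h : pieceMap liftedPath k p ∈ diag.prod diag) : k = .disk₂ 2 := by
  obtain ⟨x, s, t, u⟩ := p
  -- In every other piece some factor compares the first component with the third, or with the
  -- moving second one, and these never meet.
  cases k with
  | circles i =>
    exfalso
    fin_cases i
    · exact f₁_ne_f₃ (x 0) (x 2) h.1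
    · exact f₁_ne_H₁ (x 0) (x 1) u (Eq.symm h.1)
    · exact f₁_ne_H₁ (x 0) (x 1) u (Eq.symm h.2)
  | disk₁ i =>
    exfalso
    fin_cases i
    · exact f₁_ne_f₃ (x 0) (x 2) h.2
    · exact f₁_ne_H₁ (x 0) (x 1) u (Eq.symm h.2)
    · exact f₁_ne_f₃ (x 0) (x 2) h.1
  | disk₂ i =>
    fin_cases i
    · exact (f₁_ne_f₃ (x 0) (x 2) h.1).elim
    · exact (f₁_ne_H₁ (x 0) (x 1) u (Eq.symm h.1)).elim
    · rfl

/-- The coordinates of the point of the obstruction manifold. -/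
theorem disk₂_mem_iff {x : Fin 3 → Circle} {s t u : ℝ} :
    ((x, s, t, u) : Param) ∈ pieceSet 4 liftedPath (.disk₂ 2) ↔
    ((x 0 : ℂ).re = 1 / 2 ∧ (x 0 : ℂ).im = -(√3 / 2)) ∧ ((x 1 : ℂ).re = 0 ∧ (x 1 : ℂ).im = -1) ∧
      ((x 2 : ℂ).re = 0 ∧ (x 2 : ℂ).im = 1) ∧ s = 2 / 3 ∧ t = (2 - √3 / 2) / 3 ∧ u = 1 := by
  have h3 : √3 ^ 2 = 3 := Real.sq_sqrt (by norm_num)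
  have h3p : 0 < √3 := Real.sqrt_pos.2 (by norm_num)
  constructor
  · rintro ⟨⟨⟨ht, hts, hs⟩, hu⟩, h1, h2⟩
    dsimp only at ht hts hs hu
    change G (x 1) (x 2) u s ∈ diag at h1
    change (G (x 1) (x 2) u t).2 = f₁ (x 0) at h2
    obtain ⟨hu0, hu1, hw, -, hy0⟩ := bounds_of_G_mem_diag hu ⟨ht.trans hts, hs⟩ h1
    obtain ⟨e0, e1, e2⟩ := G_mem_diag.1 h1
    rw [G_eq] at h2
    obtain ⟨g0, g1, g2⟩ := coords_eq h2
    simp [f₁] at g0 g1 g2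
    have hx := circle_re_sq_add_im_sq (x 0)
    have hy := circle_re_sq_add_im_sq (x 1)
    have hz := circle_re_sq_add_im_sq (x 2)
    have hz0 : (x 2 : ℂ).re = 0 := by linarith
    rw [hz0, e1] at hz
    have hu : u = 1 := by nlinarith
    subst hu
    rw [g0] at hy
    have hy1 : (x 1 : ℂ).im = -1 := by nlinarith
    rw [hy1] at e2 g2
    have hx0 : (x 0 : ℂ).re = 1 / 2 := by linarith
    rw [hx0] at hx
    -- Here s = 2/3 and sin x = 3t - 2, so the condition t ≤ s of this half of the Whitney disk
    -- selects the root with sin x ≤ 0.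
    have hxi : (x 0 : ℂ).im ≤ 0 := by nlinarith
    have hx1 : (x 0 : ℂ).im = -(√3 / 2) := by
      rw [← neg_eq_iff_eq_neg, ← sq_eq_sq₀ (by linarith) (by positivity)]
      linarith
    exact ⟨⟨hx0, hx1⟩, ⟨g0, hy1⟩, ⟨hz0, e1⟩, by linarith, by linarith, rfl⟩
  · rintro ⟨⟨hx0, hx1⟩, ⟨hy0, hy1⟩, ⟨hz0, hz1⟩, rfl, rfl, rfl⟩
    have h32 : √3 ≤ 2 := by nlinarith
    refine ⟨⟨⟨by linarith, by linarith, by norm_num⟩, by norm_num⟩, ?_, ?_⟩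
    · change G (x 1) (x 2) 1 (2 / 3) ∈ diag
      rw [G_mem_diag, hz0, hy0, hz1, hy1]
      norm_num
    · change (G (x 1) (x 2) 1 ((2 - √3 / 2) / 3)).2 = f₁ (x 0)
      rw [G_eq, f₁, hy0, hy1, hx0, hx1]
      refine E3_ext ?_ ?_ ?_ <;> simp
      ring

/-- Only one piece is nonempty and it has one point, so the gluing plays no role. -/
theorem nonempty_unique_obstructionManifold :
    Nonempty (Unique (ObstructionManifold 4 liftedPath)) := by
  set x₀ : Fin 3 → Circle :=
    ![Circle.exp (-(Real.pi / 3)), Circle.exp (-(Real.pi / 2)), Circle.exp (Real.pi / 2)] with hx₀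
  have h₀ : ((x₀, 2 / 3, (2 - √3 / 2) / 3, 1) : Param) ∈ pieceSet 4 liftedPath (.disk₂ 2) := by
    rw [disk₂_mem_iff]
    simp only [hx₀, Matrix.cons_val_zero, Matrix.cons_val_one, Matrix.cons_val, exp_re, exp_im]
    simp
  refine ⟨⟨⟨Quot.mk _ ⟨.disk₂ 2, _, h₀⟩⟩, fun q => ?_⟩⟩
  induction q using Quot.ind with
  | mk q =>
  obtain ⟨k, ⟨x, s, t, u⟩, hp⟩ := q
  obtain rfl := eq_disk₂_of_mem hp.2
  obtain ⟨⟨a1, a2⟩, ⟨a3, a4⟩, ⟨a5, a6⟩, rfl, rfl, rfl⟩ := disk₂_mem_iff.1 hp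
  obtain ⟨⟨b1, b2⟩, ⟨b3, b4⟩, ⟨b5, b6⟩, -⟩ := disk₂_mem_iff.1 h₀
  have : x = x₀ := by
    funext i
    fin_cases i
    · exact circle_ext (a1.trans b1.symm) (a2.trans b2.symm)
    · exact circle_ext (a3.trans b3.symm) (a4.trans b4.symm)
    · exact circle_ext (a5.trans b5.symm) (a6.trans b6.symm)
  subst this
  rfl

theorem isTransversePath_liftedPath : IsTransversePath 4 liftedPath := by
  rintro k ⟨θ, s, t, u⟩ hK h
  obtain rfl := eq_disk₂_of_mem h
  obtain ⟨⟨a1, a2⟩, ⟨a3, a4⟩, ⟨a5, a6⟩, hs, ht, hu⟩ := disk₂_mem_iff.1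
    (show ((fun i => Circle.exp (θ i), s, t, u) : Param) ∈ pieceSet 4 liftedPath (.disk₂ 2) from
      ⟨hK, h⟩)
  rw [exp_re] at a1 a3 a5
  rw [exp_im] at a2 a4 a6
  have h3 : √3 ^ 2 = 3 := Real.sq_sqrt (by norm_num)
  have h3p : 0 < √3 := Real.sqrt_pos.2 (by norm_num)
  have h32 : √3 < 2 := by nlinarith
  have hd : ContDiff ℝ ∞ fun p : (Fin 3 → ℝ) × ℝ × ℝ × ℝ =>
      pieceMap liftedPath (.disk₂ 2) (fun i => Circle.exp (p.1 i), p.2) := by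
    have c0 : ContDiff ℝ ∞ fun p : (Fin 3 → ℝ) × ℝ × ℝ × ℝ => p.1 0 := by fun_prop
    have c1 : ContDiff ℝ ∞ fun p : (Fin 3 → ℝ) × ℝ × ℝ × ℝ => p.1 1 := by fun_prop
    have c2 : ContDiff ℝ ∞ fun p : (Fin 3 → ℝ) × ℝ × ℝ × ℝ => p.1 2 := by fun_prop
    have cs : ContDiff ℝ ∞ fun p : (Fin 3 → ℝ) × ℝ × ℝ × ℝ => p.2.1 := by fun_prop
    have ct : ContDiff ℝ ∞ fun p : (Fin 3 → ℝ) × ℝ × ℝ × ℝ => p.2.2.1 := by fun_prop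
    have cu : ContDiff ℝ ∞ fun p : (Fin 3 → ℝ) × ℝ × ℝ × ℝ => p.2.2.2 := by fun_prop
    exact (contDiff_G c1 c2 cu cs).prodMk ((contDiff_G c1 c2 cu ct).snd.prodMk (contDiff_f₁ c0))
  refine sup_diag_prod_diag_eq_top (hd.differentiable (by simp) _) fun d e => ?_
  -- The derivative of the two differences at the point, in which √3, 4/3 and 3 come from its
  -- coordinates. The system is triangular: e₀ gives v1, d₁ gives vu, and then v2, vs, v0 and vt
  -- follow.
  obtain ⟨v0, v1, v2, vs, vt, vu, hd0, hd1, hd2, he0, he1, he2⟩ :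
      ∃ v0 v1 v2 vs vt vu : ℝ, d 0 = -2 * v2 - v1 ∧ d 1 = -vu ∧ d 2 = -(4 / 3) * vu - 3 * vs ∧
        e 0 = v1 ∧ e 1 = vu - √3 * v0 ∧ e 2 = 2 * t * vu + 3 * vt - v0 / 2 := by
    refine ⟨-(e 1 + d 1) / √3, e 0, -(d 0 + e 0) / 2, (4 / 3 * d 1 - d 2) / 3,
      (e 2 + 2 * t * d 1 + -(e 1 + d 1) / √3 / 2) / 3, - d 1, ?_, ?_, ?_, rfl, ?_, ?_⟩
    · ring
    · ring
    · ring
    · rw [mul_div_cancel₀ _ h3p.ne']; ring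
    · ring
  refine ⟨(![v0, v1, v2], vs, vt, vu), mem_stratumDirections ?_, fun i => ?_, fun i => ?_⟩
  · have k1 := eventually_line_mem_Icc (a := 0) (b := 1) (t := t)
      ⟨by rw [ht]; linarith, by rw [ht]; linarith⟩ vt
    have k2 := eventually_line_mem_Icc (a := 0) (b := 1) (t := s)
      ⟨by rw [hs]; norm_num, by rw [hs]; norm_num⟩ vs
    have k3 := eventually_line_mem_Icc (a := 0) (b := 1) (t := s - t)
      ⟨by rw [ht, hs]; linarith, by rw [ht, hs]; linarith⟩ (vs - vt)
    have k4 := eventually_line_mem_Icc (a := 0) (b := 4) (t := u)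
      ⟨by rw [hu]; norm_num, by rw [hu]; norm_num⟩ vu
    filter_upwards [k1, k2, k3, k4] with r r1 r2 r3 r4
    refine ⟨⟨r1.1, ?_, r2.2⟩, r4⟩
    change t + r * vt ≤ s + r * vs
    linarith [r3.1]
  · change HasDerivAt (fun r : ℝ =>
      (G (Circle.exp (θ 1 + r * v1)) (Circle.exp (θ 2 + r * v2)) (u + r * vu) (s + r * vs)).1 i -
      (G (Circle.exp (θ 1 + r * v1)) (Circle.exp (θ 2 + r * v2)) (u + r * vu) (s + r * vs)).2 i)
      (d i) 0
    have lu := hasDerivAt_line u vu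
    have ls := hasDerivAt_line s vs
    simp only [G_eq, exp_re, exp_im]
    fin_cases i
    · change HasDerivAt (fun r : ℝ => 2 * Real.cos (θ 2 + r * v2) - Real.cos (θ 1 + r * v1)) (d 0) 0
      refine HasDerivAt.congr_deriv
        (((hasDerivAt_cos_line (θ 2) v2).const_mul 2).fun_sub (hasDerivAt_cos_line (θ 1) v1)) ?_
      rw [hd0, a6, a4]; ring
    · change HasDerivAt (fun r : ℝ => Real.sin (θ 2 + r * v2) - (u + r * vu)) (d 1) 0
      refine HasDerivAt.congr_deriv ((hasDerivAt_sin_line (θ 2) v2).fun_sub lu) ?_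
      rw [hd1, a5]; ring
    · change HasDerivAt (fun r : ℝ => 0 - (2 * Real.sin (θ 1 + r * v1)
        + (s + r * vs) * (4 * (u + r * vu) - (u + r * vu) ^ 2))) (d 2) 0
      refine HasDerivAt.congr_deriv ((((hasDerivAt_sin_line (θ 1) v1).const_mul 2).fun_add
        (ls.fun_mul ((lu.const_mul 4).fun_sub (lu.fun_pow 2)))).const_sub 0) ?_
      rw [hd2, a3, hs, hu]; simp; ring
  · change HasDerivAt (fun r : ℝ =>
      (G (Circle.exp (θ 1 + r * v1)) (Circle.exp (θ 2 + r * v2)) (u + r * vu) (t + r * vt)).2 i -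
      (f₁ (Circle.exp (θ 0 + r * v0))) i) (e i) 0
    have lu := hasDerivAt_line u vu
    have lt := hasDerivAt_line t vt
    simp only [G_eq, f₁, exp_re, exp_im]
    fin_cases i
    · change HasDerivAt (fun r : ℝ => Real.cos (θ 1 + r * v1) - 0) (e 0) 0
      refine HasDerivAt.congr_deriv ((hasDerivAt_cos_line (θ 1) v1).sub_const 0) ?_
      rw [he0, a4]; ring
    · change HasDerivAt (fun r : ℝ => (u + r * vu) - 2 * Real.cos (θ 0 + r * v0)) (e 1) 0
      refine HasDerivAt.congr_deriv (lu.fun_sub ((hasDerivAt_cos_line (θ 0) v0).const_mul 2)) ?_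
      rw [he1, a2]; ring
    · change HasDerivAt (fun r : ℝ => (2 * Real.sin (θ 1 + r * v1)
        + (t + r * vt) * (4 * (u + r * vu) - (u + r * vu) ^ 2)) - Real.sin (θ 0 + r * v0)) (e 2) 0
      refine HasDerivAt.congr_deriv ((((hasDerivAt_sin_line (θ 1) v1).const_mul 2).fun_add
        (lt.fun_mul ((lu.const_mul 4).fun_sub (lu.fun_pow 2)))).fun_sub
          (hasDerivAt_sin_line (θ 0) v0)) ?_
      rw [he2, a3, a1, hu]; simp; ring

end BorromeanRings

theorem mainTheorem6 :
    (TransverseOn {p : ℝ × ℝ × ℝ × ℝ | p.2.2.1 ∈ Set.Icc 0 4 ∧ p.2.2.2 ∈ Set.Icc 0 1}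
        (fun p => G (Circle.exp p.1) (Circle.exp p.2.1) p.2.2.1 p.2.2.2) diag ∧
      IsSmoothArc preimageG ∧
      Topology.IsEmbedding (fun q : preimageG => q.1.1) ∧
      Topology.IsEmbedding (fun q : preimageG => q.1.2.1)) ∧
    (IsLinkMap borromean ∧ IsLinkMap unlink ∧ IsUnlink unlink ∧
      IsStagePath 4 liftedPath ∧
      AtLinkMap liftedPath 0 borromean ∧ AtLinkMap liftedPath 4 unlink ∧
      IsTransversePath 4 liftedPath ∧
      Nonempty (Unique (ObstructionManifold 4 liftedPath))) ∧
    (¬ LinkHomotopic borromean unlink ∧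
      ∀ V : Fin 3 → Circle → E3, IsUnlink V → ¬ LinkHomotopic borromean V) :=
  ⟨⟨transverseOn_G, isSmoothArc_preimageG, isEmbedding_fst_preimageG, isEmbedding_snd_preimageG⟩,
    ⟨isLinkMap_borromean, isLinkMap_unlink, isUnlink_unlink, isStagePath_liftedPath,
      atLinkMap_borromean, atLinkMap_unlink, isTransversePath_liftedPath,
      nonempty_unique_obstructionManifold⟩,
    ⟨not_linkHomotopic_of_isUnlink isUnlink_unlink,
      fun _ hV => not_linkHomotopic_of_isUnlink hV⟩⟩
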